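/- Let $\Omega\subset\mathbb C$ be nonempty, $f\colon\Omega\to\mathbb C$ any function and $k\ge 2$. Matrices carry the operator norm induced by the Euclidean norm, $\overline\Omega$ is the closure of $\Omega$ in $\mathbb C$, and for $A\subset\mathbb C$ let $A'$ be the set of all $z\in A$ that lie in the closure of $A\setminus\{z\}$. **Definitions.** $\mathcal D_k(\Omega)$ is the set of diagonalizable complex $k\times k$ matrices with spectrum in $\Omega$. For $X\in\mathcal D_k(\Omega)$ put $f_{op}(X)=f[X]:=W[X]$, where $W$ is any polynomial that agrees with $f$ on the spectrum of $X$. For $A\subset\mathbb C$, $\mathcal M_k^o(A)$ is the set of complex $k\times k$ matrices $X$ with spectrum in $A$ such that every multiple root of the minimal polynomial of $X$ belongs to $A'$. For $g\colon A\to\mathbb C$ and distinct points $z_1,\dots,z_n\in A$, the divided differences are $\Delta(z_1)g=g(z_1)$ and $\Delta(z_1,\dots,z_n)g=\frac{\Delta(z_2,\dots,z_n)g-\Delta(z_1,\dots,z_{n-1})g}{z_n-z_1}$ for $n>1$. For $n\ge 0$, $g\in DDC^n(A)$ means that for every $a\in A'$ the function $(z_1,\dots,z_{n+1})\mapsto\Delta(z_1,\dots,z_{n+1})g$,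 defined on the $(n+1)$-tuples of distinct points of $A$, has a finite limit at $(a,\dots,a)$. For $n\ge 1$, $g\colon A\to\mathbb C$ is of class $TC^n$ if for every $a\in A'$ there are numbers $g^{(0)}(a),\dots,g^{(n)}(a)$ and a function $\tau_a\colon A\to\mathbb C$, continuous at $a$ with $\tau_a(a)=0$ (all of these are then unique), such that $g(z)=\sum_{j=0}^{n}\frac{g^{(j)}(a)}{j!}(z-a)^j+\tau_a(z)(z-a)^n$ for all $z\in A$, and moreover $g',\dots,g^{(n)}\colon A'\to\mathbb C$ and $A'\times A\ni(a,z)\mapsto\tau_a(z)$ are continuous. If $g$ is of class $TC^{k-1}$ and $X\in\mathcal M_k^o(A)$, put $g_{op}(X)=g[X]:=P[X]$, where $P$ is any polynomial such that, for every eigenvalue $\lambda$ of $X$, with multiplicity $p$ as a root of the minimal polynomial: $P^{(s)}(\lambda)=g^{(s)}(\lambda)$ for $0\le s<p$ if $\lambda\in A'$, and $P(\lambda)=g(\lambda)$ if $\lambda\notin A'$. (The value does not depend on $P$.) **Statement.** The following conditions are equivalent: (i) there is $\varepsilon>0$ such that for every $X_0\in\mathcal D_k(\Omega)$ the function $f_{op}$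 is uniformly continuous on $\{X\in\mathcal D_k(\Omega):\|X-X_0\|<\varepsilon\}$; (ii) $f_{op}$ is uniformly continuous on every bounded subset of $\mathcal D_k(\Omega)$; (iii) $f$ extends to a function $F\in DDC^{k-1}(\overline\Omega)$. Moreover, if $F\in DDC^{k-1}(\overline\Omega)$ is any extension of $f$, then $F$ is of class $TC^{k-1}$ (so that $F_{op}$ is defined on $\mathcal M_k^o(\overline\Omega)$), and $F_{op}\colon\mathcal M_k^o(\overline\Omega)\to\mathcal M_k(\mathbb C)$, where $\mathcal M_k(\mathbb C)$ is the set of all complex $k\times k$ matrices, is uniformly continuous on every bounded subset of $\mathcal M_k^o(\overline\Omega)$. -/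

import Mathlib

open scoped Matrix.Norms.L2Operator
open Polynomial

namespace FunCalc

/-! All functions below are total functions of a complex variable that are looked at only on
a set `Ω`: none of the notions depends on the values of `f` outside `Ω`. -/

/-- The set of all points of `Ω` which are cluster points of `Ω`. -/
def clusterPts (Ω : Set ℂ) : Set ℂ := {z | z ∈ Ω ∧ z ∈ closure (Ω \ {z})}

/-- Matrices whose spectrum is contained in `Ω`. -/
def specIn (k : ℕ) (Ω : Set ℂ) : Set (Matrix (Fin k) (Fin k) ℂ) := {X | spectrum ℂ X ⊆ Ω}

/-- A matrix is diagonalizable if it is similar to a diagonal matrix. -/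
def IsDiagonalizable {k : ℕ} (X : Matrix (Fin k) (Fin k) ℂ) : Prop :=
  ∃ P : (Matrix (Fin k) (Fin k) ℂ)ˣ,
    ((P : Matrix (Fin k) (Fin k) ℂ) * X * (↑P⁻¹ : Matrix (Fin k) (Fin k) ℂ)).IsDiag

/-- `𝒟_k(Ω)`: the diagonalizable matrices with spectrum in `Ω`. -/
def diagMat (k : ℕ) (Ω : Set ℂ) : Set (Matrix (Fin k) (Fin k) ℂ) :=
  {X | X ∈ specIn k Ω ∧ IsDiagonalizable X}

/-- `ℳ_k^o(Ω)`: the matrices with spectrum in `Ω` such that every multiple root of the minimal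
polynomial is a cluster point of `Ω`. -/
def specInO (k : ℕ) (Ω : Set ℂ) : Set (Matrix (Fin k) (Fin k) ℂ) :=
  {X | X ∈ specIn k Ω ∧
    ∀ w : ℂ, 2 ≤ (minpoly ℂ X).rootMultiplicity w → w ∈ clusterPts Ω}

/-- The matrix function `X ↦ f[X]` on diagonalizable matrices: `f[X] = W[X]` where `W` is
a polynomial which coincides with `f` on the spectrum of `X` (here the Lagrange one). -/
noncomputable def diagCalc {k : ℕ} (f : ℂ → ℂ) (X : Matrix (Fin k) (Fin k) ℂ) :
    Matrix (Fin k) (Fin k) ℂ :=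
  aeval X (Lagrange.interpolate X.charpoly.roots.toFinset id f)

/-- Taylor expansion of order `n` of `f` at `a`, on `Ω`, with coefficients `u 0, …, u n`
and remainder `τ`. -/
def IsTExpansion (Ω : Set ℂ) (f : ℂ → ℂ) (a : ℂ) (n : ℕ) (u : ℕ → ℂ) (τ : ℂ → ℂ) : Prop :=
  (∀ z ∈ Ω, f z = (∑ j ∈ Finset.range (n + 1), u j / (j.factorial : ℂ) * (z - a) ^ j) +
      τ z * (z - a) ^ n) ∧
    τ a = 0 ∧ ContinuousWithinAt τ Ω a

open Classical in
/-- The `j`-th T-derivative of `f` at `a`: the `0`-th one is `f a`; for `j > 0` it is the `j`-th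
coefficient of a Taylor expansion of `f` at `a` (`0` if there is no expansion of order `j`). -/
noncomputable def tDeriv (Ω : Set ℂ) (f : ℂ → ℂ) (j : ℕ) (a : ℂ) : ℂ :=
  if j = 0 then f a
  else if h : ∃ u : ℕ → ℂ, ∃ τ : ℂ → ℂ, IsTExpansion Ω f a j u τ then h.choose j else 0

/-- `f` is of class `TC^n` on `Ω`: for `n = 0` this is continuity; for `n > 0`, `f` has a Taylor
expansion of order `n` at every cluster point `a ∈ Ω`, the T-derivatives of orders `1, …, n` are
continuous and so is the remainder as a function of two variables. -/
def IsTC (n : ℕ) (Ω : Set ℂ) (f : ℂ → ℂ) : Prop :=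
  (n = 0 ∧ ContinuousOn f Ω) ∨
  (n ≠ 0 ∧ ∃ u : ℕ → ℂ → ℂ, ∃ τ : ℂ → ℂ → ℂ,
    (∀ a ∈ clusterPts Ω, IsTExpansion Ω f a n (fun j => u j a) (τ a)) ∧
    (∀ j, 1 ≤ j → j ≤ n → ContinuousOn (u j) (clusterPts Ω)) ∧
    ContinuousOn (fun p : ℂ × ℂ => τ p.1 p.2) (clusterPts Ω ×ˢ Ω))

/-- The polynomial `P` interpolates `f` on the spectrum of `X` together with the T-derivatives up
to the multiplicities of the minimal polynomial of `X`. -/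
def Interpolates {k : ℕ} (Ω : Set ℂ) (f : ℂ → ℂ) (X : Matrix (Fin k) (Fin k) ℂ) (P : ℂ[X]) :
    Prop :=
  ∀ w ∈ spectrum ℂ X,
    (w ∈ clusterPts Ω → ∀ s < (minpoly ℂ X).rootMultiplicity w,
      (derivative^[s] P).eval w = tDeriv Ω f s w) ∧
    (w ∉ clusterPts Ω → P.eval w = f w)

/-- The extended functional calculus on `ℳ_k^o(Ω)`: `f[X] = P[X]` where `P` is any polynomial
which interpolates `f` in the sense of `Interpolates`. -/
noncomputable def extCalc {k : ℕ} (Ω : Set ℂ) (f : ℂ → ℂ) (X : Matrix (Fin k) (Fin k) ℂ) :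
    Matrix (Fin k) (Fin k) ℂ :=
  aeval X (Classical.epsilon (Interpolates Ω f X))

/-- `divDiff f n z` is the divided difference `Δ(z₀, …, zₙ) f` of the `n + 1` points
`z₀, …, zₙ`. -/
noncomputable def divDiff (f : ℂ → ℂ) : (n : ℕ) → (Fin (n + 1) → ℂ) → ℂ
  | 0, z => f (z 0)
  | n + 1, z => (divDiff f n (Fin.tail z) - divDiff f n (Fin.init z)) / (z (Fin.last (n + 1)) - z 0)

/-- `f ∈ DDC^n(Ω)`: at every cluster point `a ∈ Ω` the divided difference of `f`, as a function of
`n + 1` distinct points of `Ω`, has a finite limit at `(a, …, a)`. -/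
def IsDDC (n : ℕ) (Ω : Set ℂ) (f : ℂ → ℂ) : Prop :=
  ∀ a ∈ clusterPts Ω, ∃ L : ℂ,
    Filter.Tendsto (divDiff f n)
      (nhdsWithin (fun _ => a) {z | (∀ j, z j ∈ Ω) ∧ Function.Injective z}) (nhds L)

/-! Well-definedness of the T-derivatives and of the extended functional calculus. -/

theorem IsTExpansion.coeff_unique {Ω : Set ℂ} {f : ℂ → ℂ} {a : ℂ} {n : ℕ} {u v : ℕ → ℂ}
    {τ ρ : ℂ → ℂ} (ha : a ∈ clusterPts Ω) (hu : IsTExpansion Ω f a n u τ)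
    (hv : IsTExpansion Ω f a n v ρ) : ∀ j ≤ n, u j = v j := by
  intro j
  induction j using Nat.strong_induction_on with
  | _ j ih =>
    intro hj
    set g : ℂ → ℂ := fun z => (∑ i ∈ Finset.range (n + 1),
      (u i / (i.factorial : ℂ) - v i / (i.factorial : ℂ)) * (z - a) ^ (i - j)) +
      (τ z - ρ z) * (z - a) ^ (n - j) with hg
    have hcont : ContinuousWithinAt g Ω a := by
      refine ContinuousWithinAt.add (Continuous.continuousWithinAt (by fun_prop)) ?_
      exact (hu.2.2.sub hv.2.2).mul (Continuous.continuousWithinAt (by fun_prop))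
    have hz : ∀ z ∈ Ω \ {a}, g z = 0 := by
      rintro z ⟨hzΩ, hza⟩
      have hne : z - a ≠ 0 := sub_ne_zero.2 hza
      have key : g z * (z - a) ^ j = 0 := by
        have h1 := hu.1 z hzΩ
        have h2 := hv.1 z hzΩ
        rw [h1] at h2
        simp only [hg, add_mul, Finset.sum_mul, mul_assoc]
        rw [← pow_add, Nat.sub_add_cancel hj]
        have : ∀ i ∈ Finset.range (n + 1),
            (u i / (i.factorial : ℂ) - v i / (i.factorial : ℂ)) * ((z - a) ^ (i - j) * (z - a) ^ j)
            = u i / (i.factorial : ℂ) * (z - a) ^ i - v i / (i.factorial : ℂ) * (z - a) ^ i := by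
          intro i hi
          rcases lt_or_ge i j with h | h
          · rw [ih i h (by omega)]; ring
          · rw [← pow_add, Nat.sub_add_cancel h]; ring
        rw [Finset.sum_congr rfl this, Finset.sum_sub_distrib]
        linear_combination h2
      exact (mul_eq_zero.1 key).resolve_right (pow_ne_zero _ hne)
    have hga : g a = 0 := by
      have : (nhdsWithin a (Ω \ {a})).NeBot := mem_closure_iff_nhdsWithin_neBot.1 ha.2
      have h1 : Filter.Tendsto g (nhdsWithin a (Ω \ {a})) (nhds (g a)) :=
        hcont.mono Set.sdiff_subset
      have h2 : Filter.Tendsto g (nhdsWithin a (Ω \ {a})) (nhds 0) :=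
        tendsto_const_nhds.congr' (by
          filter_upwards [self_mem_nhdsWithin] with z hz' using (hz z hz').symm)
      exact tendsto_nhds_unique h1 h2
    have hfac : (j.factorial : ℂ) ≠ 0 := by exact_mod_cast j.factorial_ne_zero
    have : g a = u j / (j.factorial : ℂ) - v j / (j.factorial : ℂ) := by
      simp only [hg, hu.2.1, hv.2.1, sub_self, zero_mul, add_zero]
      rw [Finset.sum_eq_single j]
      · simp
      · intro i hi hij
        rcases lt_or_gt_of_ne hij with h | h
        · rw [ih i h (by omega)]; ring
        · rw [zero_pow (by omega)]; ring
      · intro h; exact absurd (Finset.mem_range.2 (by omega)) h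
    rw [this] at hga
    field_simp at hga
    linear_combination hga

theorem IsTExpansion.truncate {Ω : Set ℂ} {f : ℂ → ℂ} {a : ℂ} {n j : ℕ} {u : ℕ → ℂ}
    {τ : ℂ → ℂ} (hu : IsTExpansion Ω f a n u τ) (hj : j ≤ n) :
    ∃ ρ, IsTExpansion Ω f a j u ρ := by
  refine ⟨fun z => (∑ i ∈ Finset.Ico (j + 1) (n + 1),
    u i / (i.factorial : ℂ) * (z - a) ^ (i - j)) + τ z * (z - a) ^ (n - j), ?_, ?_, ?_⟩
  · intro z hz
    have hs : ∀ i ∈ Finset.Ico (j + 1) (n + 1),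
        u i / (i.factorial : ℂ) * (z - a) ^ (i - j) * (z - a) ^ j =
        u i / (i.factorial : ℂ) * (z - a) ^ i := by
      intro i hi
      rw [mul_assoc, ← pow_add, Nat.sub_add_cancel (by have := (Finset.mem_Ico.1 hi).1; omega)]
    rw [hu.1 z hz, add_mul, Finset.sum_mul, mul_assoc, ← pow_add, Nat.sub_add_cancel hj,
      ← add_assoc, Finset.sum_congr rfl hs, Finset.sum_range_add_sum_Ico _ (by omega)]
  · simp only [hu.2.1, zero_mul, add_zero, sub_self]
    refine Finset.sum_eq_zero fun i hi => ?_
    rw [zero_pow (by have := (Finset.mem_Ico.1 hi).1; omega), mul_zero]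
  · refine ContinuousWithinAt.add (Continuous.continuousWithinAt (by fun_prop)) ?_
    exact hu.2.2.mul (Continuous.continuousWithinAt (by fun_prop))

theorem tDeriv_eq {Ω : Set ℂ} {f : ℂ → ℂ} {a : ℂ} {n j : ℕ} {u : ℕ → ℂ} {τ : ℂ → ℂ}
    (ha : a ∈ clusterPts Ω) (hu : IsTExpansion Ω f a n u τ) (hj : j ≤ n) :
    tDeriv Ω f j a = u j := by
  rcases Nat.eq_zero_or_pos j with rfl | hpos
  · have := hu.1 a ha.1
    rw [Finset.sum_range_succ'] at this
    simpa [tDeriv, hu.2.1] using this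
  · obtain ⟨ρ, hρ⟩ := hu.truncate hj
    have h : ∃ u : ℕ → ℂ, ∃ τ : ℂ → ℂ, IsTExpansion Ω f a j u τ := ⟨u, ρ, hρ⟩
    obtain ⟨σ, hσ⟩ := h.choose_spec
    rw [tDeriv, if_neg (by omega), dif_pos h]
    exact hσ.coeff_unique ha hρ j le_rfl

theorem mem_spectrum_of_isRoot_minpoly {k : ℕ} (X : Matrix (Fin k) (Fin k) ℂ) (w : ℂ)
    (h : (minpoly ℂ X).IsRoot w) : w ∈ spectrum ℂ X :=
  Matrix.mem_spectrum_of_isRoot_charpoly (h.dvd (Matrix.minpoly_dvd_charpoly X))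

theorem aeval_eq_of_interpolates {k : ℕ} {Ω : Set ℂ} {f : ℂ → ℂ} {X : Matrix (Fin k) (Fin k) ℂ}
    (hX : X ∈ specInO k Ω) {P Q : ℂ[X]} (hP : Interpolates Ω f X P) (hQ : Interpolates Ω f X Q) :
    aeval X P = aeval X Q := by
  by_cases hPQ : P - Q = 0
  · rw [sub_eq_zero.1 hPQ]
  have hm : minpoly ℂ X ≠ 0 := minpoly.ne_zero (Matrix.isIntegral X)
  have hdvd : minpoly ℂ X ∣ P - Q := by
    rw [IsAlgClosed.dvd_iff_roots_le_roots hm hPQ, Multiset.le_iff_count]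
    intro w
    rw [count_roots, count_roots]
    rcases Nat.eq_zero_or_pos ((minpoly ℂ X).rootMultiplicity w) with h0 | hpos
    · omega
    have hw : w ∈ spectrum ℂ X :=
      mem_spectrum_of_isRoot_minpoly X w ((rootMultiplicity_pos hm).1 hpos)
    have hlt : (minpoly ℂ X).rootMultiplicity w - 1 < (P - Q).rootMultiplicity w := by
      refine lt_rootMultiplicity_of_isRoot_iterate_derivative hPQ fun s hs => ?_
      rw [IsRoot.def, iterate_derivative_sub, eval_sub, sub_eq_zero]
      by_cases hc : w ∈ clusterPts Ω
      · rw [(hP w hw).1 hc s (by omega), (hQ w hw).1 hc s (by omega)]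
      · have h1 : (minpoly ℂ X).rootMultiplicity w < 2 := by
          by_contra hcon
          exact hc (hX.2 w (by omega))
        have hs0 : s = 0 := by omega
        subst hs0
        simpa using ((hP w hw).2 hc).trans ((hQ w hw).2 hc).symm
    omega
  have := aeval_eq_zero_of_dvd_aeval_eq_zero hdvd (minpoly.aeval ℂ X)
  rwa [map_sub, sub_eq_zero] at this

theorem exists_interpolates {k : ℕ} (Ω : Set ℂ) (f : ℂ → ℂ) (X : Matrix (Fin k) (Fin k) ℂ) :
    ∃ P, Interpolates Ω f X P := by
  classical
  set m : ℂ → ℕ := fun w => (minpoly ℂ X).rootMultiplicity w + 1 with hm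
  have hfin : (spectrum ℂ X).Finite := by
    refine (X.charpoly.roots.toFinset.finite_toSet).subset fun w hw => ?_
    simpa [X.charpoly_monic.ne_zero] using Matrix.mem_spectrum_iff_isRoot_charpoly.1 hw
  have := hfin.fintype
  let T : spectrum ℂ X → ℂ[X] := fun w => ∑ s ∈ Finset.range (m w),
    C (tDeriv Ω f s w / (s.factorial : ℂ)) * (Polynomial.X - C (w : ℂ)) ^ s
  have hco : Pairwise (Function.onFun IsCoprime
      fun w : spectrum ℂ X => Ideal.span {(Polynomial.X - C (w : ℂ)) ^ (m w)}) := by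
    intro v w hvw
    simp only [Function.onFun]
    rw [Ideal.isCoprime_span_singleton_iff]
    exact (pairwise_coprime_X_sub_C Subtype.val_injective hvw).pow
  obtain ⟨P, hP⟩ := Ideal.exists_forall_sub_mem_ideal hco T
  have main : ∀ w ∈ spectrum ℂ X, ∀ s < m w, (derivative^[s] P).eval w = tDeriv Ω f s w := by
    intro w hw s hs
    have hd : (Polynomial.X - C w) ^ (m w) ∣ P - T ⟨w, hw⟩ :=
      Ideal.mem_span_singleton.1 (hP ⟨w, hw⟩)
    have h0 : (derivative^[s] (P - T ⟨w, hw⟩)).IsRoot w := by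
      by_cases hz : P - T ⟨w, hw⟩ = 0
      · simp [hz]
      · exact isRoot_iterate_derivative_of_lt_rootMultiplicity
          (hs.trans_le ((le_rootMultiplicity_iff hz).2 hd))
    rw [IsRoot.def, iterate_derivative_sub, eval_sub, sub_eq_zero] at h0
    rw [h0, iterate_derivative_sum, eval_finsetSum, Finset.sum_eq_single s]
    · have hfac : (s.factorial : ℂ) ≠ 0 := by exact_mod_cast s.factorial_ne_zero
      rw [iterate_derivative_C_mul, iterate_derivative_X_sub_pow_self]
      simp [hfac]
    · intro i _ his
      rw [iterate_derivative_C_mul, iterate_derivative_X_sub_pow]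
      rcases lt_or_gt_of_ne his with h | h
      · simp [Nat.descFactorial_of_lt h]
      · simp [zero_pow (Nat.sub_ne_zero_of_lt h)]
    · intro h; exact absurd (Finset.mem_range.2 hs) h
  refine ⟨P, fun w hw => ⟨fun _ s hs => main w hw s (by simp only [hm]; omega), fun _ => ?_⟩⟩
  simpa [tDeriv] using main w hw 0 (by simp [hm])

theorem extCalc_eq {k : ℕ} {Ω : Set ℂ} {f : ℂ → ℂ} {X : Matrix (Fin k) (Fin k) ℂ}
    (hX : X ∈ specInO k Ω) {P : ℂ[X]} (hP : Interpolates Ω f X P) :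
    extCalc Ω f X = aeval X P :=
  aeval_eq_of_interpolates hX (Classical.epsilon_spec (exists_interpolates Ω f X)) hP

theorem diagCalc_conj {k : ℕ} (f : ℂ → ℂ) (P : (Matrix (Fin k) (Fin k) ℂ)ˣ) (d : Fin k → ℂ) :
    diagCalc f ((P : Matrix (Fin k) (Fin k) ℂ) * Matrix.diagonal d *
      (↑P⁻¹ : Matrix (Fin k) (Fin k) ℂ)) =
    (P : Matrix (Fin k) (Fin k) ℂ) * Matrix.diagonal (fun i => f (d i)) *
      (↑P⁻¹ : Matrix (Fin k) (Fin k) ℂ) := by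
  have hconj : ∀ W : ℂ[X], aeval ((P : Matrix (Fin k) (Fin k) ℂ) * Matrix.diagonal d *
      (↑P⁻¹ : Matrix (Fin k) (Fin k) ℂ)) W = (P : Matrix (Fin k) (Fin k) ℂ) *
      aeval (Matrix.diagonal d) W * (↑P⁻¹ : Matrix (Fin k) (Fin k) ℂ) := by
    intro W
    induction W using Polynomial.induction_on' with
    | add p q hp hq => rw [map_add, map_add, hp, hq, mul_add, add_mul]
    | monomial n a =>
      rw [aeval_monomial, aeval_monomial, Units.conj_pow, Algebra.algebraMap_eq_smul_one]
      simp
  have hdiag : ∀ W : ℂ[X], aeval (Matrix.diagonal d) W = Matrix.diagonal fun i => W.eval (d i) := by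
    intro W
    have h := aeval_algHom_apply (Matrix.diagonalAlgHom ℂ (n := Fin k) (α := ℂ)) d W
    simp only [Matrix.diagonalAlgHom_apply] at h
    rw [h]
    congr 1
    ext i
    simp
  rw [diagCalc, hconj, hdiag]
  congr 3
  ext i
  have hi : d i ∈ ((P : Matrix (Fin k) (Fin k) ℂ) * Matrix.diagonal d *
      (↑P⁻¹ : Matrix (Fin k) (Fin k) ℂ)).charpoly.roots.toFinset := by
    rw [Matrix.coe_units_inv, Matrix.charpoly_units_conj, Multiset.mem_toFinset,
      mem_roots (Matrix.charpoly_monic _).ne_zero, Matrix.charpoly_diagonal, IsRoot.def, eval_prod]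
    exact Finset.prod_eq_zero (Finset.mem_univ i) (by simp)
  exact Lagrange.eval_interpolate_at_node f Function.injective_id.injOn hi

end FunCalc

/-! Put A = closure Ω. Call a tuple of points of A admissible if only cluster points of A are
repeated in it. If F is in DDC^n(A), its divided differences of every order up to n extend
continuously from distinct to admissible tuples (`IsDDC.of_succ`, `IsDDC.exists_tendsto_divDiff`).
Newton's formula then gives a Hermite interpolation polynomial depending continuously on its nodes,
and evaluating it at a matrix is jointly continuous in matrix and nodes. With nodes (a, …, a, x) the
same polynomial is a Taylor expansion, which yields class TC^n.

Whenever the monic polynomial with admissible roots z annihilates M, F[M] is the Newton polynomial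
of z at M (`IsDDC.extCalc_eq`); the roots of the minimal polynomial are one such z. Since A is
closed, the bounded pairs (M, z) of this kind form a compact set. The map F_op becomes continuous
when pulled back to these pairs, and projections of compact sets are closed maps, so F_op is
continuous on a compact set containing any given bounded set, hence uniformly continuous there
(`IsDDC.uniformContinuousOn_extCalc`). On diagonalizable matrices with spectrum in Ω it coincides
with f_op, which gives (iii) → (ii).

For (i) → (iii), take the bidiagonal matrix with distinct diagonal entries z and constant
superdiagonal δ. The corner entry of its image under f_op is δ^n times the divided difference of f
at z (`diagCalc_bidiag`). For small δ ≠ 0 and z near (a, …, a), these matrices lie in one ε-ball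
about a scalar matrix, so uniform continuity forces the divided differences to converge, even when a
is only in the closure of Ω. Scalar matrices give the limits of f itself, hence the extension F. -/

namespace FunCalc

open Filter Topology

/-! ### Lagrange interpolation and divided differences -/

/-- The Lagrange interpolation polynomial of `f` at the nodes `z₀, …, zₙ`. -/
noncomputable def lagr (f : ℂ → ℂ) (n : ℕ) (z : Fin (n + 1) → ℂ) : ℂ[X] :=
  Lagrange.interpolate Finset.univ z (fun i => f (z i))

section Lagrange

variable {f : ℂ → ℂ} {n : ℕ} {z : Fin (n + 1) → ℂ}

theorem eval_lagr (hz : Function.Injective z) (i : Fin (n + 1)) :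
    (lagr f n z).eval (z i) = f (z i) :=
  Lagrange.eval_interpolate_at_node (fun i => f (z i)) hz.injOn (Finset.mem_univ i)

theorem degree_lagr_lt (hz : Function.Injective z) : (lagr f n z).degree < (n + 1 : ℕ) := by
  have := Lagrange.degree_interpolate_lt (fun i => f (z i)) hz.injOn (s := Finset.univ)
  rwa [Finset.card_univ, Fintype.card_fin] at this

theorem eq_lagr (hz : Function.Injective z) {p : ℂ[X]} (hp : p.degree < (n + 1 : ℕ))
    (h : ∀ i, p.eval (z i) = f (z i)) : p = lagr f n z :=
  Lagrange.eq_interpolate_of_eval_eq (fun i => f (z i)) hz.injOn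
    (by rwa [Finset.card_univ, Fintype.card_fin]) fun i _ => h i

theorem lagr_comp_perm (hz : Function.Injective z) (σ : Equiv.Perm (Fin (n + 1))) :
    lagr f n (z ∘ σ) = lagr f n z := by
  refine (eq_lagr (hz.comp σ.injective) (degree_lagr_lt hz) fun i => ?_).symm
  exact eval_lagr hz (σ i)

theorem injective_tail {z : Fin (n + 2) → ℂ} (hz : Function.Injective z) :
    Function.Injective (Fin.tail z : Fin (n + 1) → ℂ) :=
  hz.comp (Fin.succ_injective _)

theorem injective_init {z : Fin (n + 2) → ℂ} (hz : Function.Injective z) :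
    Function.Injective (Fin.init z : Fin (n + 1) → ℂ) :=
  hz.comp (Fin.castSucc_injective _)

theorem degree_X_sub_C_mul_lt {p : ℂ[X]} {m : ℕ} (hp : p.degree < m) (a : ℂ) :
    ((X - C a) * p).degree < ((m + 1 : ℕ) : WithBot ℕ) := by
  rw [degree_lt_iff_coeff_zero] at hp ⊢
  intro j hj
  rcases j with _ | j
  · omega
  rw [sub_mul, coeff_sub, coeff_X_mul, coeff_C_mul, hp j (by omega), hp (j + 1) (by omega)]
  simp

/-- Neville's recursion: the interpolants at the tail and at the initial nodes combine linearly into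
the interpolant at all nodes. Comparing top coefficients reproduces the recursion of divided
differences. Symmetry of divided differences follows, since the interpolant ignores the order of the
nodes. -/
theorem coeff_lagr_eq_divDiff (f : ℂ → ℂ) : ∀ (n : ℕ) {z : Fin (n + 1) → ℂ},
    Function.Injective z → (lagr f n z).coeff n = divDiff f n z
  | 0, z, _ => by
    simp [lagr, divDiff]
  | n + 1, z, hz => by
    set p := lagr f n (Fin.tail z) with hp
    set q := lagr f n (Fin.init z) with hq
    have hne : z (Fin.last (n + 1)) - z 0 ≠ 0 :=
      sub_ne_zero.2 (hz.ne (Fin.last_pos.ne'))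
    have hpd : p.degree < (n + 1 : ℕ) := degree_lagr_lt (injective_tail hz)
    have hqd : q.degree < (n + 1 : ℕ) := degree_lagr_lt (injective_init hz)
    have key : C (z (Fin.last (n + 1)) - z 0)⁻¹ *
        ((X - C (z 0)) * p - (X - C (z (Fin.last (n + 1)))) * q) = lagr f (n + 1) z := by
      refine eq_lagr hz ?_ fun i => ?_
      · rw [← smul_eq_C_mul]
        exact (degree_smul_le _ _).trans_lt ((degree_sub_le _ _).trans_lt
          (max_lt (degree_X_sub_C_mul_lt hpd _) (degree_X_sub_C_mul_lt hqd _)))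
      · have hpi : ∀ i : Fin (n + 1), p.eval (z i.succ) = f (z i.succ) :=
          fun i => eval_lagr (injective_tail hz) i
        have hqi : ∀ i : Fin (n + 1), q.eval (z i.castSucc) = f (z i.castSucc) :=
          fun i => eval_lagr (injective_init hz) i
        simp only [eval_mul, eval_C, eval_sub, eval_X]
        rw [inv_mul_eq_iff_eq_mul₀ hne]
        by_cases h0 : i = 0
        · subst h0
          have := hqi 0
          rw [Fin.castSucc_zero] at this
          rw [this]; ring
        by_cases hl : i = Fin.last (n + 1)
        · subst hl
          have := hpi (Fin.last n)
          rw [Fin.succ_last] at this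
          rw [this]; ring
        obtain ⟨j, rfl⟩ := Fin.exists_succ_eq.2 h0
        have h1 := hpi j
        obtain ⟨l, hl'⟩ := Fin.exists_castSucc_eq.2 hl
        have h2 := hqi l
        rw [hl'] at h2
        rw [h1, h2]; ring
    have hpc : p.coeff (n + 1) = 0 := coeff_eq_zero_of_degree_lt hpd
    have hqc : q.coeff (n + 1) = 0 := coeff_eq_zero_of_degree_lt hqd
    have hp1 : p.coeff n = divDiff f n (Fin.tail z) := coeff_lagr_eq_divDiff f n (injective_tail hz)
    have hq1 : q.coeff n = divDiff f n (Fin.init z) := coeff_lagr_eq_divDiff f n (injective_init hz)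
    rw [← key, coeff_C_mul, coeff_sub, sub_mul, sub_mul, coeff_sub, coeff_sub, coeff_X_mul,
      coeff_X_mul, coeff_C_mul, coeff_C_mul, hpc, hqc, hp1, hq1, divDiff]
    ring

theorem divDiff_comp_perm (f : ℂ → ℂ) (hz : Function.Injective z) (σ : Equiv.Perm (Fin (n + 1))) :
    divDiff f n (z ∘ σ) = divDiff f n z := by
  rw [← coeff_lagr_eq_divDiff f n hz, ← coeff_lagr_eq_divDiff f n (hz.comp σ.injective),
    lagr_comp_perm hz]

theorem lagr_zero (f : ℂ → ℂ) (z : Fin 1 → ℂ) : lagr f 0 z = C (f (z 0)) := by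
  simp [lagr]

/-- Newton's step: the top coefficients of the two sides agree because the nodal polynomial is
monic, so their difference has degree at most n; it vanishes at the n + 1 initial nodes, hence
identically. -/
theorem lagr_succ (f : ℂ → ℂ) {z : Fin (n + 2) → ℂ} (hz : Function.Injective z) :
    lagr f (n + 1) z = lagr f n (Fin.init z) +
      C (divDiff f (n + 1) z) * Lagrange.nodal Finset.univ (Fin.init z : Fin (n + 1) → ℂ) := by
  set N := Lagrange.nodal Finset.univ (Fin.init z : Fin (n + 1) → ℂ) with hN
  set q := lagr f n (Fin.init z) with hq
  have hNd : N.degree = (n + 1 : ℕ) := by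
    rw [hN, Lagrange.degree_nodal, Finset.card_univ, Fintype.card_fin]
  have hNm : N.Monic := Lagrange.nodal_monic
  have hNc : N.coeff (n + 1) = 1 := by
    have := hNm.coeff_natDegree
    rwa [natDegree_eq_of_degree_eq_some hNd] at this
  have hqd : q.degree < (n + 1 : ℕ) := degree_lagr_lt (injective_init hz)
  have hinj := injective_init hz
  have hzero : lagr f (n + 1) z - (q + C (divDiff f (n + 1) z) * N) = 0 := by
    refine eq_zero_of_degree_lt_of_eval_index_eq_zero (s := Finset.univ)
      (v := (Fin.init z : Fin (n + 1) → ℂ)) hinj.injOn ?_ fun i _ => ?_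
    · rw [Finset.card_univ, Fintype.card_fin, degree_lt_iff_coeff_zero]
      intro m hm
      rw [coeff_sub, coeff_add, coeff_C_mul, coeff_eq_zero_of_degree_lt
        (hqd.trans_le (by exact_mod_cast hm))]
      rcases hm.eq_or_lt with rfl | hlt
      · rw [coeff_lagr_eq_divDiff f _ hz, hNc]; ring
      · rw [coeff_eq_zero_of_degree_lt ((degree_lagr_lt hz).trans_le (by exact_mod_cast hlt)),
          coeff_eq_zero_of_degree_lt (hNd.trans_lt (by exact_mod_cast hlt))]
        ring
    · rw [eval_sub, eval_add, eval_mul, hN, Lagrange.eval_nodal_at_node (Finset.mem_univ i),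
        mul_zero, add_zero, hq, eval_lagr hinj]
      exact sub_eq_zero.2 (eval_lagr hz i.castSucc)
  exact sub_eq_zero.1 hzero

end Lagrange

/-! ### Distinct and admissible tuples -/

/-- The `(n + 1)`-tuples of distinct points of `A`. -/
def distinctTuples (n : ℕ) (A : Set ℂ) : Set (Fin (n + 1) → ℂ) :=
  {z | (∀ j, z j ∈ A) ∧ Function.Injective z}

/-- The `(n + 1)`-tuples of points of `A` in which only cluster points of `A` are repeated. -/
def admissibleTuples (n : ℕ) (A : Set ℂ) : Set (Fin (n + 1) → ℂ) :=
  {z | (∀ j, z j ∈ A) ∧ ∀ i j, i ≠ j → z i = z j → z i ∈ clusterPts A}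

section Tuples

variable {A : Set ℂ} {n : ℕ}

theorem distinctTuples_subset_admissibleTuples : distinctTuples n A ⊆ admissibleTuples n A :=
  fun _ hz => ⟨hz.1, fun _ _ hij h => absurd (hz.2 h) hij⟩

theorem const_mem_admissibleTuples {a : ℂ} (ha : a ∈ clusterPts A) :
    (fun _ => a) ∈ admissibleTuples n A :=
  ⟨fun _ => ha.1, fun _ _ _ _ => ha⟩

theorem comp_perm_mem_admissibleTuples {z : Fin (n + 1) → ℂ} (hz : z ∈ admissibleTuples n A)
    (σ : Equiv.Perm (Fin (n + 1))) : z ∘ σ ∈ admissibleTuples n A :=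
  ⟨fun j => hz.1 (σ j), fun i j hij h => hz.2 (σ i) (σ j) (σ.injective.ne hij) h⟩

theorem comp_perm_mem_distinctTuples {z : Fin (n + 1) → ℂ} (hz : z ∈ distinctTuples n A)
    (σ : Equiv.Perm (Fin (n + 1))) : z ∘ σ ∈ distinctTuples n A :=
  ⟨fun j => hz.1 (σ j), hz.2.comp σ.injective⟩

theorem init_mem_admissibleTuples {z : Fin (n + 2) → ℂ} (hz : z ∈ admissibleTuples (n + 1) A) :
    (Fin.init z : Fin (n + 1) → ℂ) ∈ admissibleTuples n A :=
  ⟨fun j => hz.1 j.castSucc, fun i j hij h =>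
    hz.2 i.castSucc j.castSucc ((Fin.castSucc_injective _).ne hij) h⟩

theorem tail_mem_admissibleTuples {z : Fin (n + 2) → ℂ} (hz : z ∈ admissibleTuples (n + 1) A) :
    (Fin.tail z : Fin (n + 1) → ℂ) ∈ admissibleTuples n A :=
  ⟨fun j => hz.1 j.succ, fun i j hij h =>
    hz.2 i.succ j.succ ((Fin.succ_injective _).ne hij) h⟩

theorem init_mem_distinctTuples {z : Fin (n + 2) → ℂ} (hz : z ∈ distinctTuples (n + 1) A) :
    (Fin.init z : Fin (n + 1) → ℂ) ∈ distinctTuples n A :=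
  ⟨fun j => hz.1 j.castSucc, injective_init hz.2⟩

theorem tail_mem_distinctTuples {z : Fin (n + 2) → ℂ} (hz : z ∈ distinctTuples (n + 1) A) :
    (Fin.tail z : Fin (n + 1) → ℂ) ∈ distinctTuples n A :=
  ⟨fun j => hz.1 j.succ, injective_tail hz.2⟩

theorem exists_near_clusterPt {a : ℂ} (ha : a ∈ clusterPts A) {ε : ℝ} (hε : 0 < ε) {T : Set ℂ}
    (hT : T.Finite) : ∃ w ∈ A, dist w a < ε ∧ w ∉ T := by
  obtain ⟨w, ⟨hw1, hw2⟩, hwA, hwa⟩ := mem_closure_iff.1 ha.2 (Metric.ball a ε ∩ (T \ {a})ᶜ)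
    (Metric.isOpen_ball.inter (hT.subset Set.sdiff_subset).isClosed.isOpen_compl)
    ⟨Metric.mem_ball_self hε, fun h => h.2 rfl⟩
  exact ⟨w, hwA, hw1, fun h => hw2 ⟨h, hwa⟩⟩

theorem exists_isolating_radius {a : ℂ} (ha : a ∈ A) (hna : a ∉ clusterPts A) :
    ∃ ε > 0, ∀ w ∈ A, dist w a < ε → w = a := by
  have h : a ∉ closure (A \ {a}) := fun h => hna ⟨ha, h⟩
  rw [Metric.mem_closure_iff] at h
  push Not at h
  obtain ⟨ε, hε, h⟩ := h
  refine ⟨ε, hε, fun w hw hd => ?_⟩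
  by_contra hne
  have := h w ⟨hw, hne⟩
  rw [dist_comm] at this
  linarith

/-- Isolated entries stay put and cluster entries move to fresh points. The forbidden finite set T
carries the induction: the tail is perturbed away from `z 0` as well, so that an isolated head can
be kept. It later also separates the new tuple from given ones. -/
theorem exists_injective_near : ∀ {m : ℕ} {z : Fin m → ℂ}, (∀ j, z j ∈ A) →
    (∀ i j, i ≠ j → z i = z j → z i ∈ clusterPts A) → ∀ {ε : ℝ}, 0 < ε → ∀ {T : Set ℂ}, T.Finite →
    ∃ w : Fin m → ℂ, Function.Injective w ∧ (∀ j, w j ∈ A) ∧ (∀ j, dist (w j) (z j) < ε) ∧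
      ∀ j, (w j ∉ T ∧ z j ∈ clusterPts A) ∨ (w j = z j ∧ z j ∉ clusterPts A)
  | 0, z, _, _, ε, _, T, _ =>
    ⟨z, fun i => i.elim0, fun i => i.elim0, fun i => i.elim0, fun i => i.elim0⟩
  | m + 1, z, hA, hz, ε, hε, T, hT => by
    obtain ⟨w, hwi, hwA, hwd, hw⟩ := exists_injective_near (z := Fin.tail z) (fun j => hA j.succ)
      (fun i j hij h => hz i.succ j.succ ((Fin.succ_injective _).ne hij) h) hε
      (hT.union (Set.finite_singleton (z 0)))
    suffices h : ∃ v ∈ A, dist v (z 0) < ε ∧ v ∉ Set.range w ∧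
        ((v ∉ T ∧ z 0 ∈ clusterPts A) ∨ (v = z 0 ∧ z 0 ∉ clusterPts A)) by
      obtain ⟨v, hvA, hvd, hvw, hv⟩ := h
      refine ⟨Fin.cons v w, Fin.cons_injective_iff.2 ⟨hvw, hwi⟩, ?_, ?_, ?_⟩
      · intro j; refine Fin.cases ?_ (fun j => ?_) j
        · exact hvA
        · exact hwA j
      · intro j; refine Fin.cases ?_ (fun j => ?_) j
        · exact hvd
        · exact hwd j
      · intro j; refine Fin.cases ?_ (fun j => ?_) j
        · exact hv
        · exact (hw j).imp (fun h => ⟨fun h' => h.1 (Or.inl h'), h.2⟩) id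
    by_cases h0 : z 0 ∈ clusterPts A
    · obtain ⟨v, hvA, hvd, hv⟩ := exists_near_clusterPt h0 hε (hT.union (Set.finite_range w))
      exact ⟨v, hvA, hvd, fun h => hv (Or.inr h), Or.inl ⟨fun h => hv (Or.inl h), h0⟩⟩
    · refine ⟨z 0, hA 0, by simpa using hε, ?_, Or.inr ⟨rfl, h0⟩⟩
      rintro ⟨j, hj⟩
      rcases hw j with h | h
      · exact h.1 (Or.inr hj)
      · exact h0 (hz 0 j.succ (Fin.succ_ne_zero j).symm (hj.symm.trans h.1))

theorem admissibleTuples_subset_closure : admissibleTuples n A ⊆ closure (distinctTuples n A) := by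
  intro z hz
  rw [Metric.mem_closure_iff]
  intro ε hε
  obtain ⟨w, hwi, hwA, hwd, -⟩ := exists_injective_near hz.1 hz.2 hε Set.finite_empty
  exact ⟨w, ⟨hwA, hwi⟩, (dist_pi_lt_iff hε).2 fun j => by rw [dist_comm]; exact hwd j⟩

/-- If a limit tuple repeated an isolated point, all sufficiently close tuples over A would have to
repeat that very point, contradicting admissibility. -/
theorem isClosed_admissibleTuples (hA : IsClosed A) : IsClosed (admissibleTuples n A) := by
  refine isClosed_of_closure_subset fun z hz => ?_
  rw [Metric.mem_closure_iff] at hz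
  have hzA : ∀ j, z j ∈ A := fun j => by
    rw [← hA.closure_eq, Metric.mem_closure_iff]
    intro ε hε
    obtain ⟨w, hw, hd⟩ := hz ε hε
    exact ⟨w j, hw.1 j, (dist_le_pi_dist z w j).trans_lt hd⟩
  refine ⟨hzA, fun i j hij h => ?_⟩
  by_contra hna
  obtain ⟨ε, hε, hiso⟩ := exists_isolating_radius (hzA i) hna
  obtain ⟨w, hw, hd⟩ := hz ε hε
  have h1 : w i = z i := hiso _ (hw.1 i) (by
    rw [dist_comm]; exact (dist_le_pi_dist z w i).trans_lt hd)
  have h2 : w j = z i := hiso _ (hw.1 j) (by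
    rw [dist_comm, h]; exact (dist_le_pi_dist z w j).trans_lt hd)
  exact hna (h1 ▸ hw.2 i j hij (h1.trans h2.symm))

theorem continuous_init : Continuous (Fin.init : (Fin (n + 2) → ℂ) → Fin (n + 1) → ℂ) :=
  continuous_pi fun j => continuous_apply j.castSucc

theorem continuous_tail : Continuous (Fin.tail : (Fin (n + 2) → ℂ) → Fin (n + 1) → ℂ) :=
  continuous_pi fun j => continuous_apply j.succ

theorem continuous_comp_perm (σ : Equiv.Perm (Fin (n + 1))) :
    Continuous (fun z : Fin (n + 1) → ℂ => z ∘ σ) :=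
  continuous_pi fun j => continuous_apply (σ j)

end Tuples

/-! ### Limits of divided differences at admissible tuples -/

theorem exists_tendsto_of_cauchy {α : Type*} [PseudoMetricSpace α] {s : Set α} {x : α} {g : α → ℂ}
    (h : ∀ ε > 0, ∃ δ > 0, ∀ y ∈ s, ∀ y' ∈ s, dist y x < δ → dist y' x < δ →
      dist (g y) (g y') < ε) : ∃ L, Tendsto g (𝓝[s] x) (𝓝 L) := by
  rcases (𝓝[s] x).eq_or_neBot with hbot | hne
  · exact ⟨0, by rw [hbot]; exact tendsto_bot⟩
  rw [← cauchy_map_iff_exists_tendsto, Metric.cauchy_iff]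
  refine ⟨hne.map g, fun ε hε => ?_⟩
  obtain ⟨δ, hδ, h⟩ := h ε hε
  refine ⟨g '' (s ∩ Metric.ball x δ), image_mem_map
    (inter_mem self_mem_nhdsWithin (mem_nhdsWithin_of_mem_nhds (Metric.ball_mem_nhds x hδ))), ?_⟩
  rintro _ ⟨y, ⟨hy, hyd⟩, rfl⟩ _ ⟨y', ⟨hy', hyd'⟩, rfl⟩
  exact h y hy y' hy' hyd hyd'

theorem continuousWithinAt_of_tendsto {α : Type*} [TopologicalSpace α] {s : Set α} {x : α}
    {g : α → ℂ} {L : ℂ} (hx : x ∈ s) (h : Tendsto g (𝓝[s] x) (𝓝 L)) : ContinuousWithinAt g s x := by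
  have : L = g x := tendsto_nhds_unique (h.mono_left (pure_le_nhdsWithin hx)) (tendsto_pure_nhds g x)
  rwa [this] at h

section DividedDifferences

variable {A : Set ℂ} {F : ℂ → ℂ} {n : ℕ}

theorem divDiff_window_sub (F : ℂ → ℂ) (n : ℕ) (s : ℕ → ℂ) (i : ℕ) (h : s (i + (n + 1)) ≠ s i) :
    divDiff F n (fun j => s (i + 1 + j)) - divDiff F n (fun j => s (i + j)) =
      divDiff F (n + 1) (fun j => s (i + j)) * (s (i + (n + 1)) - s i) := by
  have ht : (Fin.tail fun j : Fin (n + 2) => s (i + j)) = fun j : Fin (n + 1) => s (i + 1 + j) := by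
    ext j; simp only [Fin.tail, Fin.val_succ]; congr 1; omega
  have hi : (Fin.init fun j : Fin (n + 2) => s (i + j)) = fun j : Fin (n + 1) => s (i + j) := rfl
  rw [divDiff, ht, hi]
  simp only [Fin.val_last, Fin.val_zero, add_zero]
  rw [div_mul_cancel₀ _ (sub_ne_zero.2 h)]

/-- A window of length n + 1 slides along the concatenation of z and w. Each of the n + 1 shifts
changes the divided difference by one of order n + 1 times the distance between the entering and the
leaving point, hence by at most M · 2r. Disjointness of z and w keeps the points of every window
distinct. -/
theorem dist_divDiff_le {a : ℂ} {M η : ℝ} (hM : 0 ≤ M)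
    (hb : ∀ z ∈ distinctTuples (n + 1) A, (∀ j, dist (z j) a < η) → ‖divDiff F (n + 1) z‖ ≤ M)
    {z w : Fin (n + 1) → ℂ} {r : ℝ} (hr : r ≤ η) (hz : z ∈ distinctTuples n A)
    (hw : w ∈ distinctTuples n A) (hzr : ∀ j, dist (z j) a < r) (hwr : ∀ j, dist (w j) a < r)
    (hzw : ∀ i j, z i ≠ w j) :
    dist (divDiff F n w) (divDiff F n z) ≤ (n + 1) * (M * (2 * r)) := by
  set v : Fin (n + 1 + (n + 1)) → ℂ := Fin.append z w with hv
  have hvi : Function.Injective v := Fin.append_injective_iff.2 ⟨hz.2, hw.2, hzw⟩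
  have hvr : ∀ j, dist (v j) a < r := fun j =>
    Fin.addCases (fun j => by simpa [hv] using hzr j) (fun j => by rw [hv, Fin.append_right]; exact hwr j) j
  have hvA : ∀ j, v j ∈ A := fun j =>
    Fin.addCases (fun j => by simpa [hv] using hz.1 j) (fun j => by rw [hv, Fin.append_right]; exact hw.1 j) j
  -- Indexing by ℕ lets windows start anywhere; the default value `a` is never read.
  set s : ℕ → ℂ := fun i => if h : i < n + 1 + (n + 1) then v ⟨i, h⟩ else a with hs
  have hsv : ∀ i (h : i < n + 1 + (n + 1)), s i = v ⟨i, h⟩ := fun i h => by simp only [hs, dif_pos h]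
  have main : ∀ i ≤ n + 1, dist (divDiff F n fun j => s (i + j)) (divDiff F n fun j => s (0 + j)) ≤
      i * (M * (2 * r)) := by
    intro i
    induction i with
    | zero => intro _; simp
    | succ i ih =>
      intro hi
      have hne : s (i + (n + 1)) ≠ s i := by
        rw [hsv _ (by omega), hsv _ (by omega)]
        intro h
        have := congrArg Fin.val (hvi h)
        simp at this
      have h1 : ‖divDiff F (n + 1) (fun j => s (i + j))‖ ≤ M := by
        refine hb _ ⟨fun j => ?_, fun j l hjl => ?_⟩ fun j => ?_
        · beta_reduce; rw [hsv _ (by omega)]; exact hvA _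
        · simp only at hjl
          rw [hsv _ (by omega), hsv _ (by omega)] at hjl
          have := congrArg Fin.val (hvi hjl)
          simp at this
          exact Fin.ext this
        · rw [hsv _ (by omega)]; exact (hvr _).trans_le hr
      have h2 : ‖s (i + (n + 1)) - s i‖ ≤ 2 * r := by
        rw [hsv _ (by omega), hsv _ (by omega), ← dist_eq_norm]
        refine (dist_triangle_right _ _ a).trans ?_
        have := hvr ⟨i, by omega⟩
        have := hvr ⟨i + (n + 1), by omega⟩
        linarith
      have h3 : dist (divDiff F n fun j => s (i + 1 + j)) (divDiff F n fun j => s (i + j)) ≤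
          M * (2 * r) := by
        rw [dist_eq_norm, divDiff_window_sub F n s i hne, norm_mul]
        exact mul_le_mul h1 h2 (norm_nonneg _) hM
      refine (dist_triangle _ (divDiff F n fun j => s (i + j)) _).trans ?_
      have := ih (by omega)
      push_cast
      linarith
  have hz' : (fun j : Fin (n + 1) => s (0 + j)) = z := by
    ext j
    rw [hsv _ (by omega)]
    have : (⟨0 + j, by omega⟩ : Fin (n + 1 + (n + 1))) = Fin.castAdd (n + 1) j := by ext; simp
    rw [this, hv, Fin.append_left]
  have hw' : (fun j : Fin (n + 1) => s (n + 1 + j)) = w := by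
    ext j
    rw [hsv _ (by omega)]
    have : (⟨n + 1 + j, by omega⟩ : Fin (n + 1 + (n + 1))) = Fin.natAdd (n + 1) j := by ext; rfl
    rw [this, hv, Fin.append_right]
  have := main (n + 1) le_rfl
  rw [hz', hw'] at this
  exact_mod_cast this

/-- A limit in order n + 1 bounds those divided differences near (a, …, a), which makes the ones of
order n Cauchy. Two tuples may share points, so each is compared with a third tuple disjoint from
both, available because a is a cluster point. -/
theorem IsDDC.of_succ (hF : IsDDC (n + 1) A F) : IsDDC n A F := by
  intro a ha
  obtain ⟨L, hL⟩ := hF a ha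
  rw [Metric.tendsto_nhdsWithin_nhds] at hL
  obtain ⟨η, hη, hL⟩ := hL 1 one_pos
  have hM : 0 ≤ ‖L‖ + 1 := by positivity
  have hb : ∀ z ∈ distinctTuples (n + 1) A, (∀ j, dist (z j) a < η) →
      ‖divDiff F (n + 1) z‖ ≤ ‖L‖ + 1 := by
    intro z hz hd
    have := hL hz ((dist_pi_lt_iff hη).2 hd)
    rw [dist_eq_norm] at this
    have := norm_le_norm_add_norm_sub' (divDiff F (n + 1) z) L
    linarith
  refine exists_tendsto_of_cauchy fun ε hε => ?_
  set K : ℝ := (n + 1) * ((‖L‖ + 1) * 2) with hK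
  have hK0 : 0 < K := by positivity
  -- Each of the two comparisons then costs at most `K * r ≤ ε / 4`.
  set r := min η (ε / (4 * K)) with hr
  have hr0 : 0 < r := lt_min hη (by positivity)
  have hrK : K * r ≤ ε / 4 := by
    have h1 : r ≤ ε / (4 * K) := min_le_right _ _
    calc K * r ≤ K * (ε / (4 * K)) := by gcongr
      _ = ε / 4 := by field_simp
  refine ⟨r, hr0, fun y hy y' hy' hyd hyd' => ?_⟩
  rw [dist_pi_lt_iff hr0] at hyd hyd'
  obtain ⟨w, hwi, hwA, hwd, hw⟩ := exists_injective_near (m := n + 1) (z := fun _ => a)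
    (fun _ => ha.1) (fun _ _ _ _ => ha) hr0 ((Set.finite_range y).union (Set.finite_range y'))
  have hwT : ∀ j, w j ∉ Set.range y ∪ Set.range y' := fun j =>
    (hw j).elim (fun h => h.1) fun h => absurd ha h.2
  have h1 := dist_divDiff_le hM hb (min_le_left _ _) hy ⟨hwA, hwi⟩ hyd hwd
    fun i j h => hwT j (Or.inl ⟨i, h⟩)
  have h2 := dist_divDiff_le hM hb (min_le_left _ _) hy' ⟨hwA, hwi⟩ hyd' hwd
    fun i j h => hwT j (Or.inr ⟨i, h⟩)
  have h3 := dist_triangle_left (divDiff F n y) (divDiff F n y') (divDiff F n w)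
  have : (n + 1 : ℝ) * ((‖L‖ + 1) * (2 * r)) = K * r := by rw [hK]; ring
  rw [this] at h1 h2
  linarith

theorem IsDDC.of_le (hF : IsDDC n A F) {m : ℕ} (hm : m ≤ n) : IsDDC m A F := by
  induction hm using Nat.decreasingInduction with
  | self => exact hF
  | of_succ k _ ih => exact ih.of_succ

theorem IsDDC.continuousOn (hF : IsDDC n A F) : ContinuousOn F A := by
  intro a ha
  by_cases hc : a ∈ clusterPts A
  · obtain ⟨L, hL⟩ := hF.of_le (Nat.zero_le n) a hc
    refine continuousWithinAt_of_tendsto ha (L := L) ?_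
    -- Every 1-tuple is injective, so the limit in order 0 is taken over all points of A, including
    -- a itself, and must equal `F a`.
    have hcont : ContinuousWithinAt (fun x => (fun _ => x : Fin 1 → ℂ)) A a :=
      (continuous_pi fun _ => continuous_id).continuousWithinAt
    have := hL.comp (hcont.tendsto_nhdsWithin (t := {z | (∀ j, z j ∈ A) ∧ Function.Injective z})
      fun x hx => ⟨fun _ => hx, Function.injective_of_subsingleton _⟩)
    exact this
  · obtain ⟨ε, hε, h⟩ := exists_isolating_radius ha hc
    rw [Metric.continuousWithinAt_iff]
    exact fun e he => ⟨ε, hε, fun x hx hd => by rw [h x hx hd, dist_self]; exact he⟩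

theorem continuousOn_divDiff (hF : ContinuousOn F A) :
    ∀ n, ContinuousOn (divDiff F n) (distinctTuples n A)
  | 0 => hF.comp (continuous_apply 0).continuousOn fun _ hz => hz.1 0
  | n + 1 => by
    refine ContinuousOn.div (ContinuousOn.sub ?_ ?_) (Continuous.continuousOn (by fun_prop)) ?_
    · exact (continuousOn_divDiff hF n).comp continuous_tail.continuousOn
        fun _ hz => tail_mem_distinctTuples hz
    · exact (continuousOn_divDiff hF n).comp continuous_init.continuousOn
        fun _ hz => init_mem_distinctTuples hz
    · exact fun z hz => sub_ne_zero.2 (hz.2.ne Fin.last_pos.ne')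

/-- The hypothesis covers constant tuples. In any other tuple a swap makes the first and last
entries differ, so the recursive quotient has a nonzero limiting denominator and induction applies;
symmetry undoes the swap. -/
theorem IsDDC.exists_tendsto_divDiff (hF : IsDDC n A F) {z : Fin (n + 1) → ℂ}
    (hz : z ∈ admissibleTuples n A) :
    ∃ L, Tendsto (divDiff F n) (𝓝[distinctTuples n A] z) (𝓝 L) := by
  induction n with
  | zero =>
    exact ⟨_, continuousOn_divDiff hF.continuousOn 0 z
      ⟨hz.1, Function.injective_of_subsingleton (α := Fin 1) _⟩⟩
  | succ n ih =>
    have step : ∀ z ∈ admissibleTuples (n + 1) A, z (Fin.last (n + 1)) ≠ z 0 →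
        ∃ L, Tendsto (divDiff F (n + 1)) (𝓝[distinctTuples (n + 1) A] z) (𝓝 L) := by
      intro z hz hne
      obtain ⟨L₁, h₁⟩ := ih hF.of_succ (tail_mem_admissibleTuples hz)
      obtain ⟨L₂, h₂⟩ := ih hF.of_succ (init_mem_admissibleTuples hz)
      refine ⟨(L₁ - L₂) / (z (Fin.last (n + 1)) - z 0), Tendsto.div (Tendsto.sub ?_ ?_) ?_
        (sub_ne_zero.2 hne)⟩
      · exact h₁.comp (continuous_tail.continuousWithinAt.tendsto_nhdsWithin
          fun _ h => tail_mem_distinctTuples h)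
      · exact h₂.comp (continuous_init.continuousWithinAt.tendsto_nhdsWithin
          fun _ h => init_mem_distinctTuples h)
      · exact (show Continuous fun w : Fin (n + 2) → ℂ => w (Fin.last (n + 1)) - w 0 by
          fun_prop).continuousWithinAt
    by_cases hconst : ∀ i, z i = z 0
    · have hz0 : z = fun _ => z 0 := funext hconst
      rw [hz0]
      exact hF (z 0) (hz.2 0 (Fin.last (n + 1)) Fin.last_pos.ne (hconst _).symm)
    push Not at hconst
    obtain ⟨i, hi⟩ := hconst
    set σ : Equiv.Perm (Fin (n + 2)) := Equiv.swap i (Fin.last (n + 1)) with hσ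
    have hi0 : (0 : Fin (n + 2)) ≠ i := fun h => hi (by rw [← h])
    obtain ⟨L, hL⟩ := step (z ∘ σ) (comp_perm_mem_admissibleTuples hz σ) (by
      simp only [Function.comp, hσ, Equiv.swap_apply_right]
      rwa [Equiv.swap_apply_of_ne_of_ne hi0 Fin.last_pos.ne])
    refine ⟨L, (hL.comp ((continuous_comp_perm σ).continuousWithinAt.tendsto_nhdsWithin
      fun _ h => comp_perm_mem_distinctTuples h σ)).congr' ?_⟩
    filter_upwards [self_mem_nhdsWithin] with w hw
    exact divDiff_comp_perm F hw.2 σ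

/-- The confluent divided difference of `F` on `A`: the continuous extension of `divDiff F n` from
the tuples of distinct points. -/
noncomputable def extDiff (A : Set ℂ) (F : ℂ → ℂ) (n : ℕ) : (Fin (n + 1) → ℂ) → ℂ :=
  extendFrom (distinctTuples n A) (divDiff F n)

theorem IsDDC.continuousOn_extDiff (hF : IsDDC n A F) :
    ContinuousOn (extDiff A F n) (admissibleTuples n A) :=
  continuousOn_extendFrom admissibleTuples_subset_closure fun _ hz => hF.exists_tendsto_divDiff hz

theorem extDiff_eq_divDiff (hF : ContinuousOn F A) {z : Fin (n + 1) → ℂ}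
    (hz : z ∈ distinctTuples n A) : extDiff A F n z = divDiff F n z :=
  extendFrom_extends (continuousOn_divDiff hF n) z hz

end DividedDifferences

/-! ### Hermite interpolation in Newton form and Taylor expansions -/

/-- The Newton form of the Hermite interpolation polynomial of `F` at the nodes `z₀, …, zₙ`. -/
noncomputable def newtonPoly (A : Set ℂ) (F : ℂ → ℂ) : (n : ℕ) → (Fin (n + 1) → ℂ) → ℂ[X]
  | 0, z => C (extDiff A F 0 z)
  | n + 1, z => newtonPoly A F n (Fin.init z) + C (extDiff A F (n + 1) z) *
      Lagrange.nodal Finset.univ (Fin.init z : Fin (n + 1) → ℂ)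

section Newton

variable {A : Set ℂ} {F : ℂ → ℂ} {n : ℕ}

theorem continuous_aeval_nodal (R : Type*) [Ring R] [Algebra ℂ R] [TopologicalSpace R]
    [IsTopologicalRing R] [ContinuousSMul ℂ R] : ∀ m : ℕ,
    Continuous fun p : R × (Fin m → ℂ) => aeval p.1 (Lagrange.nodal Finset.univ p.2)
  | 0 => by simpa [Lagrange.nodal_eq] using continuous_const
  | m + 1 => by
    have h := (continuous_aeval_nodal R m).comp (f := fun p : R × (Fin (m + 1) → ℂ) =>
      ((p.1, fun i => p.2 i.castSucc) : R × (Fin m → ℂ))) (by fun_prop)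
    have h2 : Continuous fun p : R × (Fin (m + 1) → ℂ) =>
        p.1 - p.2 (Fin.last m) • (1 : R) := by fun_prop
    have := h.mul h2
    simp only [Lagrange.nodal_eq, Fin.prod_univ_castSucc, map_mul, map_sub, aeval_X, aeval_C,
      Algebra.algebraMap_eq_smul_one]
    exact this

/-- Used with R = ℂ for density arguments about the polynomial itself, and with R the matrix algebra
for the functional calculus. -/
theorem IsDDC.continuousOn_aeval_newtonPoly (hF : IsDDC n A F) (R : Type*) [Ring R] [Algebra ℂ R]
    [TopologicalSpace R] [IsTopologicalRing R] [ContinuousSMul ℂ R] :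
    ContinuousOn (fun p : R × (Fin (n + 1) → ℂ) => aeval p.1 (newtonPoly A F n p.2))
      (Set.univ ×ˢ admissibleTuples n A) := by
  induction n with
  | zero =>
    have h := hF.continuousOn_extDiff.comp (continuous_snd (X := R)).continuousOn
      (s := Set.univ ×ˢ admissibleTuples 0 A) fun _ hp => hp.2
    have := h.smul (continuousOn_const (c := (1 : R)))
    simp only [newtonPoly, aeval_C, Algebra.algebraMap_eq_smul_one]
    exact this
  | succ n ih =>
    have h := hF.continuousOn_extDiff.comp (continuous_snd (X := R)).continuousOn
      (s := Set.univ ×ˢ admissibleTuples (n + 1) A) fun _ hp => hp.2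
    have hc : Continuous fun p : R × (Fin (n + 2) → ℂ) =>
        ((p.1, Fin.init p.2) : R × (Fin (n + 1) → ℂ)) :=
      continuous_fst.prodMk (continuous_init.comp continuous_snd)
    have h1 := (ih hF.of_succ).comp hc.continuousOn (s := Set.univ ×ˢ admissibleTuples (n + 1) A)
      fun _ hp => ⟨trivial, init_mem_admissibleTuples hp.2⟩
    have h2 := ((continuous_aeval_nodal R (n + 1)).comp hc).continuousOn
      (s := Set.univ ×ˢ admissibleTuples (n + 1) A)
    have := h1.add (h.smul h2)
    simp only [newtonPoly, map_add, map_mul, aeval_C, ← Algebra.smul_def]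
    exact this

theorem IsDDC.continuousOn_eval_newtonPoly (hF : IsDDC n A F) {x : (Fin (n + 1) → ℂ) → ℂ}
    (hx : Continuous x) :
    ContinuousOn (fun z => (newtonPoly A F n z).eval (x z)) (admissibleTuples n A) := by
  have := (hF.continuousOn_aeval_newtonPoly ℂ).comp (hx.prodMk continuous_id).continuousOn
    (s := admissibleTuples n A) fun _ hz => ⟨trivial, hz⟩
  simpa [Function.comp_def, coe_aeval_eq_eval] using this

theorem newtonPoly_eq_lagr (hF : ContinuousOn F A) : ∀ {n : ℕ} {z : Fin (n + 1) → ℂ},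
    z ∈ distinctTuples n A → newtonPoly A F n z = lagr F n z
  | 0, z, hz => by rw [newtonPoly, extDiff_eq_divDiff hF hz, lagr_zero, divDiff]
  | n + 1, z, hz => by
    rw [newtonPoly, extDiff_eq_divDiff hF hz, newtonPoly_eq_lagr hF (init_mem_distinctTuples hz),
      lagr_succ F hz.2]

/-- Both sides are continuous on admissible tuples and equal the Lagrange polynomial on the dense
set of distinct ones. The interpolation property at the nodes is obtained in the same way. -/
theorem IsDDC.newtonPoly_comp_perm (hF : IsDDC n A F) {z : Fin (n + 1) → ℂ}
    (hz : z ∈ admissibleTuples n A) (σ : Equiv.Perm (Fin (n + 1))) :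
    newtonPoly A F n (z ∘ σ) = newtonPoly A F n z := by
  refine Polynomial.funext fun x => ?_
  refine Set.EqOn.of_subset_closure
    (f := fun z : Fin (n + 1) → ℂ => (newtonPoly A F n (z ∘ σ)).eval x)
    (g := fun z => (newtonPoly A F n z).eval x) (fun w hw => ?_) ?_
    (hF.continuousOn_eval_newtonPoly continuous_const) distinctTuples_subset_admissibleTuples
    admissibleTuples_subset_closure hz
  · simp only
    rw [newtonPoly_eq_lagr hF.continuousOn hw, newtonPoly_eq_lagr hF.continuousOn
      (comp_perm_mem_distinctTuples hw σ), lagr_comp_perm hw.2]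
  · exact (hF.continuousOn_eval_newtonPoly continuous_const).comp
      (continuous_comp_perm σ).continuousOn fun w hw => comp_perm_mem_admissibleTuples hw σ

theorem IsDDC.eval_newtonPoly (hF : IsDDC n A F) {z : Fin (n + 1) → ℂ}
    (hz : z ∈ admissibleTuples n A) (i : Fin (n + 1)) :
    (newtonPoly A F n z).eval (z i) = F (z i) := by
  refine Set.EqOn.of_subset_closure (f := fun z => (newtonPoly A F n z).eval (z i))
    (g := fun z => F (z i)) (fun w hw => ?_)
    (hF.continuousOn_eval_newtonPoly (continuous_apply i))
    (hF.continuousOn.comp (continuous_apply i).continuousOn fun w hw => hw.1 i)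
    distinctTuples_subset_admissibleTuples admissibleTuples_subset_closure hz
  simp only
  rw [newtonPoly_eq_lagr hF.continuousOn hw, eval_lagr hw.2]

theorem newtonPoly_const (A : Set ℂ) (F : ℂ → ℂ) (n : ℕ) (w : ℂ) :
    newtonPoly A F n (fun _ => w) =
      ∑ j ∈ Finset.range (n + 1), C (extDiff A F j fun _ => w) * (X - C w) ^ j := by
  induction n with
  | zero => simp [newtonPoly]
  | succ n ih =>
    have : (Fin.init fun _ : Fin (n + 2) => w) = fun _ : Fin (n + 1) => w := rfl
    rw [newtonPoly, this, ih, Finset.sum_range_succ _ (n + 1), Lagrange.nodal_eq]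
    simp

theorem X_sub_C_pow_dvd_nodal {m p : ℕ} (hp : p ≤ m) {z : Fin m → ℂ} {w : ℂ}
    (hz : ∀ i, i.val < p → z i = w) : (X - C w) ^ p ∣ Lagrange.nodal Finset.univ z := by
  rw [Lagrange.nodal_eq]
  refine dvd_trans (dvd_of_eq ?_) (Finset.prod_dvd_prod_of_subset
    (Finset.univ.filter fun i : Fin m => i.val < p) _ _ (Finset.subset_univ _))
  rw [Finset.prod_congr rfl (g := fun _ => X - C w) fun i hi => by
    rw [hz i (Finset.mem_filter.1 hi).2], Finset.prod_const, Fin.card_filter_val_lt, min_eq_right hp]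

/-- When the first p nodes equal w, every Newton term from the p-th on contains the factor (X −
w)^p, so modulo that power only the confluent initial part survives. -/
theorem X_sub_C_pow_dvd_newtonPoly_sub (A : Set ℂ) (F : ℂ → ℂ) {n p : ℕ} (hp : p ≤ n + 1)
    {z : Fin (n + 1) → ℂ} {w : ℂ} (hz : ∀ i, i.val < p → z i = w) :
    (X - C w) ^ p ∣ newtonPoly A F n z -
      ∑ j ∈ Finset.range p, C (extDiff A F j fun _ => w) * (X - C w) ^ j := by
  rcases hp.eq_or_lt with rfl | hlt
  · have : z = fun _ => w := funext fun i => hz i i.2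
    rw [this, newtonPoly_const, sub_self]
    exact dvd_zero _
  induction n with
  | zero =>
    have : p = 0 := by omega
    subst this
    simp
  | succ n ih =>
    have h1 : (X - C w) ^ p ∣ newtonPoly A F n (Fin.init z) -
        ∑ j ∈ Finset.range p, C (extDiff A F j fun _ => w) * (X - C w) ^ j := by
      have hz' : ∀ i : Fin (n + 1), i.val < p → (Fin.init z : Fin (n + 1) → ℂ) i = w :=
        fun i hi => hz i.castSucc hi
      rcases (Nat.lt_succ_iff.1 hlt).eq_or_lt with rfl | hlt'
      · have : Fin.init z = fun _ => w := funext fun i => hz' i i.2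
        rw [this, newtonPoly_const, sub_self]
        exact dvd_zero _
      · exact ih hlt'.le hz' hlt'
    rw [newtonPoly, add_sub_right_comm]
    exact dvd_add h1 (dvd_mul_of_dvd_right
      (X_sub_C_pow_dvd_nodal (by omega) fun i hi => hz i.castSucc hi) _)

theorem eval_iterate_derivative_of_dvd {P : ℂ[X]} {c : ℕ → ℂ} {w : ℂ} {p s : ℕ} (hs : s < p)
    (h : (X - C w) ^ p ∣ P - ∑ j ∈ Finset.range p, C (c j) * (X - C w) ^ j) :
    (derivative^[s] P).eval w = s.factorial * c s := by
  set T := ∑ j ∈ Finset.range p, C (c j) * (X - C w) ^ j with hT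
  have h0 : (derivative^[s] (P - T)).IsRoot w := by
    by_cases hz : P - T = 0
    · simp [hz]
    · exact isRoot_iterate_derivative_of_lt_rootMultiplicity
        (hs.trans_le ((le_rootMultiplicity_iff hz).2 h))
  rw [IsRoot.def, iterate_derivative_sub, eval_sub, sub_eq_zero] at h0
  rw [h0, hT, iterate_derivative_sum, eval_finsetSum, Finset.sum_eq_single s]
  · rw [iterate_derivative_C_mul, iterate_derivative_X_sub_pow_self]
    simp [mul_comm]
  · intro i _ his
    rw [iterate_derivative_C_mul, iterate_derivative_X_sub_pow]
    rcases lt_or_gt_of_ne his with h | h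
    · simp [Nat.descFactorial_of_lt h]
    · simp [zero_pow (Nat.sub_ne_zero_of_lt h)]
  · intro h; exact absurd (Finset.mem_range.2 hs) h

/-- By symmetry the occurrences of w may be moved to the front; the derivatives at w are then read
off modulo the corresponding power of X − w. -/
theorem IsDDC.eval_iterate_derivative_newtonPoly (hF : IsDDC n A F) {z : Fin (n + 1) → ℂ}
    (hz : z ∈ admissibleTuples n A) {w : ℂ} {s : ℕ}
    (hs : s < Fintype.card {i // z i = w}) :
    (derivative^[s] (newtonPoly A F n z)).eval w = s.factorial * extDiff A F s fun _ => w := by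
  set p := Fintype.card {i // z i = w} with hp
  have hpn : p ≤ n + 1 := by
    simpa using Fintype.card_subtype_le fun i => z i = w
  have hcard : Fintype.card {i : Fin (n + 1) // i.val < p} = Fintype.card {i // z i = w} := by
    rw [Fintype.card_subtype, Fin.card_filter_val_lt, min_eq_right hpn]
  set e := Fintype.equivOfCardEq hcard
  set σ : Equiv.Perm (Fin (n + 1)) := e.extendSubtype
  have hσ : ∀ i, i.val < p → (z ∘ σ) i = w := fun i hi => e.extendSubtype_mem i hi
  rw [← hF.newtonPoly_comp_perm hz σ]
  exact eval_iterate_derivative_of_dvd hs (X_sub_C_pow_dvd_newtonPoly_sub A F hpn hσ)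

theorem snoc_mem_admissibleTuples {a x : ℂ} (ha : a ∈ clusterPts A) (hx : x ∈ A) :
    (Fin.snoc (fun _ => a) x : Fin (n + 1) → ℂ) ∈ admissibleTuples n A := by
  refine ⟨fun j => ?_, fun i j hij h => ?_⟩
  · refine Fin.lastCases ?_ (fun j => ?_) j
    · rw [Fin.snoc_last]; exact hx
    · rw [Fin.snoc_castSucc]; exact ha.1
  · revert hij h
    refine Fin.lastCases ?_ (fun i => ?_) i
    · refine Fin.lastCases (fun h => absurd rfl h) (fun j _ h => ?_) j
      rw [h, Fin.snoc_castSucc]; exact ha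
    · intro _ _
      rw [Fin.snoc_castSucc]; exact ha

theorem continuous_snoc_const :
    Continuous fun p : ℂ × ℂ => (Fin.snoc (fun _ => p.1) p.2 : Fin (n + 1) → ℂ) := by
  refine continuous_pi fun j => ?_
  refine Fin.lastCases ?_ (fun j => ?_) j
  · simpa using continuous_snd
  · simpa using continuous_fst

/-- The remainder of the Taylor expansion of `F` of order `n`. -/
noncomputable def taylorRem (A : Set ℂ) (F : ℂ → ℂ) (n : ℕ) (a x : ℂ) : ℂ :=
  extDiff A F n (Fin.snoc (fun _ => a) x) - extDiff A F n fun _ => a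

theorem IsDDC.continuousOn_taylorRem (hF : IsDDC n A F) :
    ContinuousOn (fun p : ℂ × ℂ => taylorRem A F n p.1 p.2) (clusterPts A ×ˢ A) := by
  refine ContinuousOn.sub ?_ ?_
  · exact hF.continuousOn_extDiff.comp continuous_snoc_const.continuousOn
      fun p hp => snoc_mem_admissibleTuples hp.1 hp.2
  · exact hF.continuousOn_extDiff.comp
      (continuous_pi fun _ => continuous_fst).continuousOn
      fun p hp => const_mem_admissibleTuples hp.1

/-- At the nodes (a, …, a, x), with n copies of a, the Newton polynomial takes the value F(x) at x.
Its last term has the divided difference of these nodes as coefficient of (x − a)^n; subtracting the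
confluent value at a leaves the remainder. -/
theorem IsDDC.isTExpansion (hF : IsDDC n A F) {a : ℂ} (ha : a ∈ clusterPts A) :
    IsTExpansion A F a n (fun j => j.factorial * extDiff A F j fun _ => a) (taylorRem A F n a) := by
  have hsnoc : (Fin.snoc (fun _ => a) a : Fin (n + 1) → ℂ) = fun _ => a := by
    ext j
    refine Fin.lastCases ?_ (fun j => ?_) j <;> simp
  refine ⟨fun x hx => ?_, ?_, ?_⟩
  · have hsum : (∑ j ∈ Finset.range (n + 1),
        (j.factorial * extDiff A F j fun _ => a) / (j.factorial : ℂ) * (x - a) ^ j) =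
        ∑ j ∈ Finset.range (n + 1), (extDiff A F j fun _ => a) * (x - a) ^ j := by
      refine Finset.sum_congr rfl fun j _ => ?_
      rw [mul_div_cancel_left₀ _ (by exact_mod_cast j.factorial_ne_zero)]
    have hev := hF.eval_newtonPoly (snoc_mem_admissibleTuples (n := n) ha hx) (Fin.last n)
    rw [Fin.snoc_last] at hev
    rw [hsum, Finset.sum_range_succ, taylorRem, ← hev]
    cases n with
    | zero => simp [newtonPoly]
    | succ n =>
      rw [newtonPoly, Fin.init_snoc, newtonPoly_const, eval_add, eval_finsetSum,
        Lagrange.nodal_eq]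
      simp
      ring
  · rw [taylorRem, hsnoc, sub_self]
  · have := hF.continuousOn_taylorRem.comp (f := fun x : ℂ => ((a, x) : ℂ × ℂ))
      (Continuous.continuousOn (by fun_prop)) (s := A) fun x hx => ⟨ha, hx⟩
    exact this a ha.1

theorem IsDDC.isTC (hn : n ≠ 0) (hF : IsDDC n A F) : IsTC n A F := by
  refine Or.inr ⟨hn, fun j a => j.factorial * extDiff A F j fun _ => a, taylorRem A F n,
    fun a ha => hF.isTExpansion ha, fun j _ hj => ?_, hF.continuousOn_taylorRem⟩
  refine continuousOn_const.mul ((hF.of_le hj).continuousOn_extDiff.comp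
    (continuous_pi fun _ => continuous_id).continuousOn fun a ha => const_mem_admissibleTuples ha)

end Newton

/-! ### Uniform continuity of the extended calculus -/

section ExtendedCalculus

variable {k n : ℕ} {A : Set ℂ} {F : ℂ → ℂ} {M : Matrix (Fin k) (Fin k) ℂ}

theorem isRoot_of_mem_spectrum {p : ℂ[X]} (hp : aeval M p = 0) {w : ℂ} (hw : w ∈ spectrum ℂ M) :
    p.IsRoot w := by
  rcases subsingleton_or_nontrivial (Matrix (Fin k) (Fin k) ℂ) with hs | hs
  · rw [spectrum.of_subsingleton] at hw
    exact hw.elim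
  · have : p.eval w ∈ spectrum ℂ (aeval M p) := spectrum.subset_polynomial_aeval M p ⟨w, hw, rfl⟩
    rw [hp, spectrum.zero_eq] at this
    exact this

theorem rootMultiplicity_nodal {m : ℕ} (z : Fin m → ℂ) (w : ℂ) :
    (Lagrange.nodal Finset.univ z).rootMultiplicity w = Fintype.card {i // z i = w} := by
  have h : Lagrange.nodal Finset.univ z =
      ((Finset.univ.val.map z).map fun a => X - C a).prod := by
    rw [Lagrange.nodal_eq, Multiset.map_map]
    rfl
  rw [← count_roots, h, roots_multiset_prod_X_sub_C, Multiset.count_map, Fintype.card_subtype]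
  simp only [eq_comm (a := w)]
  rfl

theorem rootMultiplicity_minpoly_le {p : ℂ[X]} (hp0 : p ≠ 0) (hp : aeval M p = 0) (w : ℂ) :
    (minpoly ℂ M).rootMultiplicity w ≤ p.rootMultiplicity w :=
  rootMultiplicity_le_rootMultiplicity_of_dvd hp0 (minpoly.dvd ℂ M hp) w

theorem mem_specInO_of_aeval_nodal {z : Fin (n + 1) → ℂ} (hz : z ∈ admissibleTuples n A)
    (hM : aeval M (Lagrange.nodal Finset.univ z) = 0) : M ∈ specInO k A := by
  refine ⟨fun w hw => ?_, fun w hw => ?_⟩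
  · have := isRoot_of_mem_spectrum hM hw
    rw [IsRoot.def, Lagrange.eval_nodal, Finset.prod_eq_zero_iff] at this
    obtain ⟨i, -, hi⟩ := this
    rw [sub_eq_zero.1 hi]
    exact hz.1 i
  · have h := hw.trans (rootMultiplicity_minpoly_le Lagrange.nodal_ne_zero hM w)
    rw [rootMultiplicity_nodal] at h
    obtain ⟨i, j, hij⟩ := Fintype.one_lt_card_iff.1 h
    rw [← i.2]
    exact hz.2 i j (fun h => hij (Subtype.ext h)) (i.2.trans j.2.symm)

theorem IsDDC.tDeriv_eq (hF : IsDDC n A F) {a : ℂ} (ha : a ∈ clusterPts A) {s : ℕ} (hs : s ≤ n) :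
    tDeriv A F s a = s.factorial * extDiff A F s fun _ => a :=
  FunCalc.tDeriv_eq ha (hF.isTExpansion ha) hs

/-- Each eigenvalue occurs in z at least as often as its multiplicity in the minimal polynomial, so
the Newton polynomial meets all required conditions. Allowing any annihilating z, not just the roots
of the minimal polynomial, makes the relation between M and z closed under limits. -/
theorem IsDDC.extCalc_eq (hF : IsDDC n A F) {z : Fin (n + 1) → ℂ} (hz : z ∈ admissibleTuples n A)
    (hM : aeval M (Lagrange.nodal Finset.univ z) = 0) :
    extCalc A F M = aeval M (newtonPoly A F n z) := by
  refine FunCalc.extCalc_eq (mem_specInO_of_aeval_nodal hz hM)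
    fun w hw => ⟨fun hc s hs => ?_, fun _ => ?_⟩
  · have hs' : s < Fintype.card {i // z i = w} := by
      rw [← rootMultiplicity_nodal]
      exact hs.trans_le (rootMultiplicity_minpoly_le Lagrange.nodal_ne_zero hM w)
    have hsn : s ≤ n := by
      have : Fintype.card {i // z i = w} ≤ n + 1 := by
        simpa using Fintype.card_subtype_le fun i => z i = w
      omega
    rw [hF.eval_iterate_derivative_newtonPoly hz hs', hF.tDeriv_eq hc hsn]
  · have := isRoot_of_mem_spectrum hM hw
    rw [IsRoot.def, Lagrange.eval_nodal, Finset.prod_eq_zero_iff] at this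
    obtain ⟨i, -, hi⟩ := this
    rw [sub_eq_zero.1 hi]
    exact hF.eval_newtonPoly hz i

/-- The minimal polynomial is needed here: the characteristic polynomial may have an isolated point
of A as a multiple root. The price is a tuple length that varies with M, which is why all orders
below k are used. -/
theorem exists_admissibleTuple (hk : 0 < k) (hM : M ∈ specInO k A) :
    ∃ n < k, ∃ z ∈ admissibleTuples n A,
      Lagrange.nodal Finset.univ z = minpoly ℂ M ∧ ∀ i, z i ∈ spectrum ℂ M := by
  have : Nonempty (Fin k) := ⟨⟨0, hk⟩⟩
  have hmon : (minpoly ℂ M).Monic := minpoly.monic (Matrix.isIntegral M)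
  have hpos : 0 < (minpoly ℂ M).natDegree := minpoly.natDegree_pos (Matrix.isIntegral M)
  have hle : (minpoly ℂ M).natDegree ≤ k := by
    have := natDegree_le_of_dvd (Matrix.minpoly_dvd_charpoly M) (Matrix.charpoly_monic M).ne_zero
    rwa [Matrix.charpoly_natDegree_eq_dim, Fintype.card_fin] at this
  obtain ⟨n, hn⟩ : ∃ n, (minpoly ℂ M).natDegree = n + 1 := ⟨_, (Nat.succ_pred_eq_of_pos hpos).symm⟩
  obtain ⟨l, hl⟩ := Quot.exists_rep (minpoly ℂ M).roots
  have hlen : l.length = n + 1 := by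
    rw [← hn, ← IsAlgClosed.card_roots_eq_natDegree, ← hl]; rfl
  obtain ⟨z, hz⟩ : ∃ z : Fin (n + 1) → ℂ, Finset.univ.val.map z = (minpoly ℂ M).roots := by
    rw [← hl, ← hlen]
    exact ⟨l.get, by rw [Fin.univ_val_map, List.ofFn_get]; rfl⟩
  have hnod : Lagrange.nodal Finset.univ z = minpoly ℂ M := by
    rw [(IsAlgClosed.splits (minpoly ℂ M)).eq_prod_roots_of_monic hmon, ← hz, Lagrange.nodal_eq,
      Multiset.map_map]
    rfl
  have hspec : ∀ i, z i ∈ spectrum ℂ M := fun i => by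
    refine mem_spectrum_of_isRoot_minpoly M _ ?_
    rw [← hnod, IsRoot.def, Lagrange.eval_nodal_at_node (Finset.mem_univ i)]
  refine ⟨n, by omega, z, ⟨fun i => hM.1 (hspec i), fun i j hij h => hM.2 _ ?_⟩, hnod, hspec⟩
  rw [← hnod, rootMultiplicity_nodal]
  exact Fintype.one_lt_card_iff.2 ⟨⟨i, rfl⟩, ⟨j, h.symm⟩, fun h => hij (congrArg Subtype.val h)⟩

/-- Pairs of a matrix `M` of norm at most `R` and an admissible tuple of norm at most `R'` whose
nodal polynomial annihilates `M`. -/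
def annihilatedPairs (k n : ℕ) (A : Set ℂ) (R R' : ℝ) :
    Set (Matrix (Fin k) (Fin k) ℂ × (Fin (n + 1) → ℂ)) :=
  (Metric.closedBall 0 R ×ˢ Metric.closedBall 0 R') ∩
    ({p | p.2 ∈ admissibleTuples n A} ∩ {p | aeval p.1 (Lagrange.nodal Finset.univ p.2) = 0})

theorem isCompact_annihilatedPairs (hA : IsClosed A) (R R' : ℝ) :
    IsCompact (annihilatedPairs k n A R R') := by
  refine ((isCompact_closedBall _ _).prod (isCompact_closedBall _ _)).inter_right
    (((isClosed_admissibleTuples hA).preimage continuous_snd).inter ?_)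
  exact isClosed_singleton.preimage (continuous_aeval_nodal (Matrix (Fin k) (Fin k) ℂ) (n + 1))

theorem IsDDC.uniformContinuousOn_extCalc (hk : 0 < k) (hA : IsClosed A) (hF : IsDDC (k - 1) A F)
    {S : Set (Matrix (Fin k) (Fin k) ℂ)} (hS : S ⊆ specInO k A) (hb : Bornology.IsBounded S) :
    UniformContinuousOn (extCalc A F) S := by
  obtain ⟨R, hR⟩ := hb.subset_closedBall 0
  -- Eigenvalues of M are bounded by ‖M‖ · ‖1‖, so the nodes stay in a fixed ball.
  set R' := R * ‖(1 : Matrix (Fin k) (Fin k) ℂ)‖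
  set K : ∀ n : ℕ, Set (Matrix (Fin k) (Fin k) ℂ × (Fin (n + 1) → ℂ)) :=
    fun n => annihilatedPairs k n A R R'
  have hKc : ∀ n, IsCompact (K n) := fun n => isCompact_annihilatedPairs hA R R'
  set U : Set (Matrix (Fin k) (Fin k) ℂ) := ⋃ n ∈ Finset.range k, Prod.fst '' K n with hU
  have hUc : IsCompact U := (Finset.range k).isCompact_biUnion fun n _ =>
    (hKc n).image continuous_fst
  have hSU : S ⊆ U := by
    intro M hM
    obtain ⟨n, hn, z, hz, hnod, hspec⟩ := exists_admissibleTuple hk (hS hM)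
    refine Set.mem_biUnion (Finset.mem_coe.2 (Finset.mem_range.2 hn))
      ⟨(M, z), ⟨⟨hR hM, ?_⟩, hz, ?_⟩, rfl⟩
    · have hMR : ‖M‖ ≤ R := by simpa using hR hM
      have hR0 : 0 ≤ R := (norm_nonneg _).trans hMR
      rw [mem_closedBall_zero_iff, pi_norm_le_iff_of_nonneg (by positivity)]
      exact fun i => (spectrum.norm_le_norm_mul_of_mem (hspec i)).trans
        (mul_le_mul_of_nonneg_right hMR (norm_nonneg _))
    · exact (congrArg (aeval M) hnod).trans (minpoly.aeval ℂ M)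
  refine (hUc.uniformContinuousOn_of_continuous ?_).mono hSU
  -- The preimage of a closed t is the union over n < k of the projections of the pairs whose Newton
  -- value lies in t; each projection is compact, hence closed.
  rw [continuousOn_iff_isClosed]
  intro t ht
  have hG : ∀ n < k, ContinuousOn (fun p : Matrix (Fin k) (Fin k) ℂ × (Fin (n + 1) → ℂ) =>
      aeval p.1 (newtonPoly A F n p.2)) (K n) := fun n hn =>
    ((hF.of_le (by omega)).continuousOn_aeval_newtonPoly _).mono fun p hp => ⟨trivial, hp.2.1⟩
  refine ⟨⋃ n ∈ Finset.range k, Prod.fst '' (K n ∩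
    (fun p => aeval p.1 (newtonPoly A F n p.2)) ⁻¹' t), ?_, ?_⟩
  · refine (Finset.range k).finite_toSet.isClosed_biUnion fun n hn => ?_
    have hcl := (hG n (Finset.mem_range.1 hn)).preimage_isClosed_of_isClosed (hKc n).isClosed ht
    exact (((hKc n).of_isClosed_subset hcl Set.inter_subset_left).image continuous_fst).isClosed
  · ext M
    simp only [hU, Set.mem_inter_iff, Set.mem_preimage, Set.mem_iUnion, Finset.mem_range]
    constructor
    · rintro ⟨hMt, n, hn, ⟨M', z⟩, hp, rfl⟩
      refine ⟨⟨n, hn, (M', z), ⟨hp, ?_⟩, rfl⟩, n, hn, (M', z), hp, rfl⟩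
      have := (hF.of_le (by omega : n ≤ k - 1)).extCalc_eq hp.2.1 hp.2.2
      simp only at this hMt
      rw [this] at hMt
      exact hMt
    · rintro ⟨⟨n, hn, ⟨M', z⟩, ⟨hp, hpt⟩, rfl⟩, h⟩
      refine ⟨?_, h⟩
      have := (hF.of_le (by omega : n ≤ k - 1)).extCalc_eq hp.2.1 hp.2.2
      simp only at this ⊢
      rw [this]
      exact hpt

end ExtendedCalculus

/-! ### Comparison with the calculus on diagonalizable matrices -/

section DiagonalizableCalculus

variable {k : ℕ} {Ω A : Set ℂ} {f F : ℂ → ℂ} {M : Matrix (Fin k) (Fin k) ℂ}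

theorem IsDiagonalizable.exists_conj (hM : IsDiagonalizable M) :
    ∃ (P : (Matrix (Fin k) (Fin k) ℂ)ˣ) (d : Fin k → ℂ),
      M = (P : Matrix (Fin k) (Fin k) ℂ) * Matrix.diagonal d *
        (↑P⁻¹ : Matrix (Fin k) (Fin k) ℂ) := by
  obtain ⟨P, hP⟩ := hM
  refine ⟨P⁻¹, Matrix.diag ((P : Matrix (Fin k) (Fin k) ℂ) * M *
    (↑P⁻¹ : Matrix (Fin k) (Fin k) ℂ)), ?_⟩
  rw [hP.diagonal_diag]
  simp [mul_assoc]

theorem aeval_conj_diagonal (P : (Matrix (Fin k) (Fin k) ℂ)ˣ) (d : Fin k → ℂ) (W : ℂ[X]) :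
    aeval ((P : Matrix (Fin k) (Fin k) ℂ) * Matrix.diagonal d *
      (↑P⁻¹ : Matrix (Fin k) (Fin k) ℂ)) W =
    (P : Matrix (Fin k) (Fin k) ℂ) * Matrix.diagonal (fun i => W.eval (d i)) *
      (↑P⁻¹ : Matrix (Fin k) (Fin k) ℂ) := by
  induction W using Polynomial.induction_on' with
  | add p q hp hq =>
    rw [map_add, hp, hq, ← add_mul, ← mul_add, Matrix.diagonal_add]
    simp only [eval_add]
  | monomial n a =>
    rw [aeval_monomial, Units.conj_pow, Algebra.algebraMap_eq_smul_one, Matrix.diagonal_pow,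
      smul_one_mul, ← smul_mul_assoc, ← mul_smul_comm, ← Matrix.diagonal_smul]
    congr 3
    ext i
    simp

theorem rootMultiplicity_minpoly_le_one (hM : IsDiagonalizable M) (w : ℂ) :
    (minpoly ℂ M).rootMultiplicity w ≤ 1 := by
  obtain ⟨P, d, rfl⟩ := hM.exists_conj
  set q : ℂ[X] := ∏ a ∈ Finset.univ.image d, (X - C a) with hq
  have hroots : q.roots = (Finset.univ.image d).val := roots_prod_X_sub_C _
  refine (rootMultiplicity_minpoly_le (p := q) ?_ ?_ w).trans ?_
  · exact (monic_prod_of_monic _ _ fun a _ => monic_X_sub_C a).ne_zero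
  · have h0 : (fun i => q.eval (d i)) = 0 := by
      ext i
      rw [hq, eval_prod]
      exact Finset.prod_eq_zero (Finset.mem_image_of_mem d (Finset.mem_univ i)) (by simp)
    rw [aeval_conj_diagonal, h0]
    simp
  · rw [← count_roots, hroots]
    exact Multiset.nodup_iff_count_le_one.1 (Finset.nodup _) w

theorem diagMat_subset_specInO (h : Ω ⊆ A) : diagMat k Ω ⊆ specInO k A := fun _ hM =>
  ⟨hM.1.trans h, fun w hw => by have := rootMultiplicity_minpoly_le_one hM.2 w; omega⟩

/-- The minimal polynomial of a diagonalizable matrix has simple roots, so no derivative condition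
remains and the Lagrange polynomial of f qualifies. -/
theorem extCalc_eq_diagCalc (h : Ω ⊆ A) (hF : Set.EqOn F f Ω) (hM : M ∈ diagMat k Ω) :
    extCalc A F M = diagCalc f M := by
  have key : ∀ w ∈ spectrum ℂ M,
      (Lagrange.interpolate M.charpoly.roots.toFinset id f).eval w = F w := by
    intro w hw
    rw [hF (hM.1 hw)]
    refine Lagrange.eval_interpolate_at_node f Function.injective_id.injOn (i := w) ?_
    rw [Multiset.mem_toFinset, mem_roots M.charpoly_monic.ne_zero]
    exact Matrix.mem_spectrum_iff_isRoot_charpoly.1 hw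
  refine extCalc_eq (diagMat_subset_specInO h hM) fun w hw => ⟨fun _ s hs => ?_, fun _ => key w hw⟩
  have := rootMultiplicity_minpoly_le_one hM.2 w
  have hs0 : s = 0 := by omega
  subst hs0
  simpa [tDeriv] using key w hw

theorem diagCalc_eq_aeval (hM : IsDiagonalizable M) {p : ℂ[X]}
    (hp : ∀ w ∈ spectrum ℂ M, p.eval w = f w) : diagCalc f M = aeval M p := by
  obtain ⟨P, d, rfl⟩ := hM.exists_conj
  rw [diagCalc_conj, aeval_conj_diagonal]
  congr 3
  ext i
  refine (hp _ ?_).symm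
  rw [Matrix.mem_spectrum_iff_isRoot_charpoly, Matrix.coe_units_inv, Matrix.charpoly_units_conj,
    Matrix.charpoly_diagonal, IsRoot.def, eval_prod]
  exact Finset.prod_eq_zero (Finset.mem_univ i) (by simp)

end DiagonalizableCalculus

/-! ### Bidiagonal matrices as detectors of divided differences -/

section Bidiagonal

variable {k n : ℕ} {Ω : Set ℂ} {f : ℂ → ℂ}

theorem isDiagonalizable_of_injective {M : Matrix (Fin k) (Fin k) ℂ} {z : Fin k → ℂ}
    (hz : Function.Injective z) (hM : ∀ i, z i ∈ spectrum ℂ M) : IsDiagonalizable M := by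
  have hev : ∀ i, ∃ v, Module.End.HasEigenvector (Matrix.toLin' M) (z i) v := fun i =>
    (Module.End.hasEigenvalue_iff_mem_spectrum.2
      (by rw [Matrix.spectrum_toLin']; exact hM i)).exists_hasEigenvector
  choose v hv using hev
  set V : Matrix (Fin k) (Fin k) ℂ := Matrix.of fun i j => v j i with hV
  have hunit : IsUnit V := Matrix.linearIndependent_cols_iff_isUnit.1
    (Module.End.eigenvectors_linearIndependent' (Matrix.toLin' M) z hz v hv)
  obtain ⟨P, hP⟩ := hunit
  have hMV : M * V = V * Matrix.diagonal z := by
    ext i j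
    have := congrFun (hv j).apply_eq_smul i
    rw [Matrix.toLin'_apply] at this
    rw [Matrix.mul_diagonal, Matrix.mul_apply]
    simpa [Matrix.mulVec, dotProduct, hV, mul_comm] using this
  refine ⟨P⁻¹, ?_⟩
  rw [inv_inv, mul_assoc, hP, hMV, ← mul_assoc, ← hP, Units.inv_mul, one_mul]
  exact Matrix.isDiag_diagonal z

/-- The nilpotent matrix with ones on the first superdiagonal. -/
def superdiag (n : ℕ) : Matrix (Fin (n + 1)) (Fin (n + 1)) ℂ :=
  Matrix.of fun i j => if i.val + 1 = j.val then 1 else 0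

/-- The upper bidiagonal matrix with diagonal `z` and constant superdiagonal `δ`. -/
noncomputable def bidiag (n : ℕ) (δ : ℂ) (z : Fin (n + 1) → ℂ) :
    Matrix (Fin (n + 1)) (Fin (n + 1)) ℂ :=
  Matrix.diagonal z + δ • superdiag n

theorem mem_spectrum_bidiag {δ : ℂ} {z : Fin (n + 1) → ℂ} {w : ℂ} :
    w ∈ spectrum ℂ (bidiag n δ z) ↔ ∃ i, z i = w := by
  have htri : (bidiag n δ z).IsUpperTriangular := by
    intro i j hij
    have hij' : j.val < i.val := hij
    have h1 : i ≠ j := fun h => by rw [h] at hij'; omega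
    have h2 : ¬ i.val + 1 = j.val := by omega
    simp [bidiag, superdiag, Matrix.diagonal_apply_ne _ h1, h2]
  rw [Matrix.mem_spectrum_iff_isRoot_charpoly, Matrix.charpoly_of_isUpperTriangular _ htri,
    IsRoot.def, eval_prod, Finset.prod_eq_zero_iff]
  simp [bidiag, superdiag, sub_eq_zero, eq_comm]

theorem bidiag_mem_diagMat (δ : ℂ) {z : Fin (n + 1) → ℂ} (hz : z ∈ distinctTuples n Ω) :
    bidiag n δ z ∈ diagMat (n + 1) Ω := by
  refine ⟨fun w hw => ?_, isDiagonalizable_of_injective hz.2 fun i => mem_spectrum_bidiag.2 ⟨i, rfl⟩⟩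
  obtain ⟨i, rfl⟩ := mem_spectrum_bidiag.1 hw
  exact hz.1 i

/-- The entry (0, l) of the j-th power sums weights of paths of length j from 0 to l, each step
staying or moving up by one. There is none if j < l, and only the straight one, of weight δ^j, if j
= l. -/
theorem bidiag_pow_apply (δ : ℂ) (z : Fin (n + 1) → ℂ) (j : ℕ) : ∀ l : Fin (n + 1),
    (j < l.val → (bidiag n δ z ^ j) 0 l = 0) ∧ (j = l.val → (bidiag n δ z ^ j) 0 l = δ ^ j) := by
  have hb : ∀ m l : Fin (n + 1), m ≠ l → m.val + 1 ≠ l.val → bidiag n δ z m l = 0 := by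
    intro m l h1 h2
    simp [bidiag, superdiag, Matrix.diagonal_apply_ne _ h1, h2]
  induction j with
  | zero =>
    intro l
    constructor
    · intro h
      rw [pow_zero, Matrix.one_apply_ne]
      rintro rfl
      exact lt_irrefl _ h
    · intro h
      have : l = 0 := Fin.ext h.symm
      rw [this, pow_zero, pow_zero, Matrix.one_apply_eq]
  | succ j ih =>
    intro l
    rw [pow_succ (bidiag n δ z), Matrix.mul_apply]
    constructor
    · intro h
      refine Finset.sum_eq_zero fun m _ => ?_
      by_cases hm : j < m.val
      · rw [(ih m).1 hm, zero_mul]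
      · rw [hb m l (fun h' => by rw [h'] at hm; omega) (by omega), mul_zero]
    · intro h
      have hl := l.2
      set m₀ : Fin (n + 1) := ⟨j, by omega⟩ with hm₀
      rw [Finset.sum_eq_single m₀]
      · have h1 : m₀ ≠ l := fun h' => by
          have := congrArg Fin.val h'; simp only [hm₀] at this; omega
        rw [(ih m₀).2 rfl, pow_succ]
        rw [bidiag, Matrix.add_apply, Matrix.diagonal_apply_ne _ h1]
        simp [superdiag, hm₀, h]
      · intro m _ hm
        by_cases hjm : j < m.val
        · rw [(ih m).1 hjm, zero_mul]
        · have hmj : m.val ≠ j := fun h' => hm (Fin.ext h')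
          rw [hb m l (fun h' => by rw [h'] at hjm; omega) (by omega), mul_zero]
      · exact fun h' => absurd (Finset.mem_univ _) h'

/-- The interpolant has degree at most n and powers below the n-th have zero corner entry, so only
its coefficient of degree n contributes. -/
theorem diagCalc_bidiag (f : ℂ → ℂ) (δ : ℂ) {z : Fin (n + 1) → ℂ} (hz : z ∈ distinctTuples n Ω) :
    diagCalc f (bidiag n δ z) 0 (Fin.last n) = δ ^ n * divDiff f n z := by
  have hdeg := degree_lagr_lt (f := f) hz.2
  rw [diagCalc_eq_aeval (bidiag_mem_diagMat δ hz).2 (p := lagr f n z) (fun w hw => by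
      obtain ⟨i, rfl⟩ := mem_spectrum_bidiag.1 hw
      exact eval_lagr hz.2 i),
    aeval_eq_sum_range' (n := n + 1) ?_, Matrix.sum_apply, Finset.sum_range_succ,
    Finset.sum_eq_zero, zero_add, Matrix.smul_apply, (bidiag_pow_apply δ z n (Fin.last n)).2 rfl,
    coeff_lagr_eq_divDiff f n hz.2, smul_eq_mul, mul_comm]
  · intro j hj
    rw [Matrix.smul_apply, (bidiag_pow_apply δ z j (Fin.last n)).1 (by simpa using hj), smul_zero]
  · by_cases h0 : lagr f n z = 0
    · rw [h0]; simp
    · exact (natDegree_lt_iff_degree_lt h0).2 hdeg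

theorem dist_bidiag (δ : ℂ) (z w : Fin (n + 1) → ℂ) :
    dist (bidiag n δ z) (bidiag n δ w) = dist z w := by
  rw [dist_eq_norm, bidiag, bidiag, add_sub_add_right_eq_sub, Matrix.diagonal_sub,
    Matrix.l2_opNorm_diagonal, dist_eq_norm]
  rfl

theorem diagonal_mem_diagMat {d : Fin k → ℂ} (hd : ∀ i, d i ∈ Ω) :
    Matrix.diagonal d ∈ diagMat k Ω := by
  refine ⟨fun w hw => ?_, 1, ?_⟩
  · rw [Matrix.mem_spectrum_iff_isRoot_charpoly, Matrix.charpoly_diagonal, IsRoot.def, eval_prod,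
      Finset.prod_eq_zero_iff] at hw
    obtain ⟨i, -, hi⟩ := hw
    rw [eval_sub, eval_X, eval_C, sub_eq_zero] at hi
    exact hi ▸ hd i
  · simp

theorem diagCalc_diagonal (f : ℂ → ℂ) (d : Fin k → ℂ) :
    diagCalc f (Matrix.diagonal d) = Matrix.diagonal fun i => f (d i) := by
  simpa using diagCalc_conj f 1 d

/-- Uniform continuity yields a Cauchy condition at x, so neither x ∈ s nor T x ∈ S is needed; this
reaches boundary points outside Ω. -/
theorem exists_tendsto_entry {α : Type*} [PseudoMetricSpace α]
    {Φ : Matrix (Fin k) (Fin k) ℂ → Matrix (Fin k) (Fin k) ℂ} {S : Set (Matrix (Fin k) (Fin k) ℂ)}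
    (hΦ : UniformContinuousOn Φ S) (T : α → Matrix (Fin k) (Fin k) ℂ) (i j : Fin k) {s : Set α}
    {x : α} {r : ℝ} (hr : 0 < r) (hTS : ∀ y ∈ s, dist y x < r → T y ∈ S)
    (hT : ∀ y y', dist (T y) (T y') ≤ dist y y') :
    ∃ L, Tendsto (fun y => Φ (T y) i j) (𝓝[s] x) (𝓝 L) := by
  have hent : UniformContinuous fun M : Matrix (Fin k) (Fin k) ℂ => M i j :=
    (LinearMap.toContinuousLinearMap (Matrix.entryLinearMap ℂ ℂ i j)).uniformContinuous
  have hu := hent.comp_uniformContinuousOn hΦ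
  rw [Metric.uniformContinuousOn_iff] at hu
  refine exists_tendsto_of_cauchy fun ε hε => ?_
  obtain ⟨δ, hδ, h⟩ := hu ε hε
  refine ⟨min r (δ / 2), lt_min hr (by positivity), fun y hy y' hy' hd hd' => ?_⟩
  refine h _ (hTS y hy (hd.trans_le (min_le_left _ _))) _
    (hTS y' hy' (hd'.trans_le (min_le_left _ _))) ((hT y y').trans_lt ?_)
  have h1 := hd.trans_le (min_le_right _ _)
  have h2 := hd'.trans_le (min_le_right _ _)
  have := dist_triangle_right y y' x
  linarith

end Bidiagonal

/-! ### Extending f to the closure -/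

section Extension

variable {n : ℕ} {Ω : Set ℂ} {f : ℂ → ℂ}

theorem distinctTuples_closure_subset :
    distinctTuples n (closure Ω) ⊆ closure (distinctTuples n Ω) := by
  intro z hz
  have hopen : IsOpen {w : Fin (n + 1) → ℂ | Function.Injective w} := by
    have : {w : Fin (n + 1) → ℂ | Function.Injective w} =
        ⋂ i, ⋂ j, {w : Fin (n + 1) → ℂ | i ≠ j → w i ≠ w j} := by
      ext w
      simp only [Set.mem_iInter]
      exact ⟨fun h i j hij => h.ne hij, fun h i j hij => not_imp_not.1 (h i j) hij⟩
    rw [this]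
    refine isOpen_iInter_of_finite fun i => isOpen_iInter_of_finite fun j => ?_
    by_cases hij : i = j
    · simp [hij]
    · simpa [hij] using isOpen_ne_fun (continuous_apply i) (continuous_apply j)
  have hcl : z ∈ closure (Set.univ.pi fun _ : Fin (n + 1) => Ω) := by
    rw [closure_pi_set]
    exact fun i _ => hz.1 i
  refine closure_mono ?_ (hopen.inter_closure ⟨hz.2, hcl⟩)
  exact fun w hw => ⟨fun j => hw.2 j trivial, hw.1⟩

/-- The limits are known only along tuples from Ω. These are dense among the distinct tuples of the
closure together with (a, …, a), so the extension by continuity is continuous on that larger set,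
where it agrees with the divided differences of F at distinct tuples. -/
theorem isDDC_closure {F : ℂ → ℂ} (hF : ContinuousOn F (closure Ω)) (hfF : Set.EqOn F f Ω)
    (h : ∀ a ∈ closure Ω, ∃ L,
      Tendsto (divDiff f n) (𝓝[distinctTuples n Ω] fun _ => a) (𝓝 L)) :
    IsDDC n (closure Ω) F := by
  intro a ha
  have hcong : ∀ m, ∀ z : Fin (m + 1) → ℂ, (∀ j, z j ∈ Ω) → divDiff F m z = divDiff f m z := by
    intro m
    induction m with
    | zero => exact fun z hz => hfF (hz 0)
    | succ m ih =>
      intro z hz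
      rw [divDiff, divDiff, ih (Fin.tail z) fun j => hz j.succ, ih (Fin.init z) fun j => hz j.castSucc]
  have hsub : distinctTuples n Ω ⊆ distinctTuples n (closure Ω) :=
    fun z hz => ⟨fun j => subset_closure (hz.1 j), hz.2⟩
  have hcont := continuousOn_divDiff hF n
  set B : Set (Fin (n + 1) → ℂ) := insert (fun _ => a) (distinctTuples n (closure Ω)) with hB
  have hBcl : B ⊆ closure (distinctTuples n Ω) := by
    refine Set.insert_subset ?_ distinctTuples_closure_subset
    exact closure_minimal distinctTuples_closure_subset isClosed_closure
      (admissibleTuples_subset_closure (const_mem_admissibleTuples ha))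
  have hlim : ∀ z ∈ B, ∃ L, Tendsto (divDiff F n) (𝓝[distinctTuples n Ω] z) (𝓝 L) := by
    rintro z (rfl | hz)
    · obtain ⟨L, hL⟩ := h a ha.1
      refine ⟨L, hL.congr' ?_⟩
      filter_upwards [self_mem_nhdsWithin] with w hw
      exact (hcong n w hw.1).symm
    · exact ⟨_, (hcont z hz).mono_left (nhdsWithin_mono z hsub)⟩
  have hext := continuousOn_extendFrom hBcl hlim
  refine ⟨_, ((hext _ (Set.mem_insert _ _)).mono_left
    (nhdsWithin_mono _ (Set.subset_insert _ _))).congr' ?_⟩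
  filter_upwards [self_mem_nhdsWithin] with z hz
  exact extendFrom_eq (distinctTuples_closure_subset hz)
    ((hcont z hz).mono_left (nhdsWithin_mono z hsub))

theorem exists_isDDC_extension {ε : ℝ} (hε : 0 < ε)
    (h : ∀ X₀ ∈ diagMat (n + 1) Ω,
      UniformContinuousOn (diagCalc f) {M | M ∈ diagMat (n + 1) Ω ∧ ‖M - X₀‖ < ε}) :
    ∃ F : ℂ → ℂ, Set.EqOn F f Ω ∧ IsDDC n (closure Ω) F := by
  -- The superdiagonal uses one half of the radius ε and the diagonal the other. The added 1 keeps
  -- the denominator positive even when `superdiag n` is zero.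
  obtain ⟨δ, hδ0, hδ⟩ : ∃ δ : ℂ, δ ≠ 0 ∧ ‖δ • superdiag n‖ < ε / 2 := by
    have hc : 0 < ‖superdiag n‖ + 1 := by positivity
    refine ⟨((ε / 2 / (‖superdiag n‖ + 1) : ℝ) : ℂ), by
      exact_mod_cast (by positivity : (ε / 2 / (‖superdiag n‖ + 1) : ℝ) ≠ 0), ?_⟩
    rw [norm_smul, Complex.norm_real, Real.norm_of_nonneg (by positivity), div_mul_eq_mul_div,
      div_lt_iff₀ hc]
    exact mul_lt_mul_of_pos_left (by linarith) (by positivity)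
  -- The centre of the ball must have its spectrum in Ω, while a is only in the closure; hence the
  -- scalar matrix of a nearby b ∈ Ω.
  have hnear : ∀ a ∈ closure Ω, ∃ b ∈ Ω, dist a b < ε / 4 := fun a ha =>
    Metric.mem_closure_iff.1 ha _ (by positivity)
  have hdiag : ∀ a b : ℂ, dist a b < ε / 4 → ∀ d : Fin (n + 1) → ℂ,
      dist d (fun _ => a) < ε / 4 → ‖Matrix.diagonal d - Matrix.diagonal fun _ => b‖ < ε / 2 := by
    intro a b hab d hd
    have : ‖d - fun _ => b‖ < ε / 2 := by
      rw [← dist_eq_norm]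
      have h1 : dist (fun _ : Fin (n + 1) => a) (fun _ => b) = dist a b := dist_pi_const a b
      have := dist_triangle d (fun _ => a) (fun _ => b)
      linarith
    rw [Matrix.diagonal_sub, Matrix.l2_opNorm_diagonal]
    exact this
  -- Scalar matrices reduce the calculus to f itself.
  have hf : ∀ a ∈ closure Ω, ∃ L, Tendsto f (𝓝[Ω] a) (𝓝 L) := by
    intro a ha
    obtain ⟨b, hb, hab⟩ := hnear a ha
    obtain ⟨L, hL⟩ := exists_tendsto_entry (h (Matrix.diagonal fun _ => b)
      (diagonal_mem_diagMat fun _ => hb)) (fun w : ℂ => Matrix.diagonal fun _ => w) 0 0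
      (s := Ω) (x := a) (r := ε / 4) (by positivity)
      (fun y hy hd => ⟨diagonal_mem_diagMat fun _ => hy, (hdiag a b hab (fun _ => y)
        (by rwa [dist_pi_const])).trans (by linarith)⟩)
      (fun y y' => by
        rw [dist_eq_norm, Matrix.diagonal_sub, Matrix.l2_opNorm_diagonal, dist_eq_norm,
          pi_norm_const])
    refine ⟨L, ?_⟩
    simpa [diagCalc_diagonal] using hL
  have hfc : ContinuousOn f Ω := fun a ha => by
    obtain ⟨L, hL⟩ := hf a (subset_closure ha)
    exact continuousWithinAt_of_tendsto ha hL
  refine ⟨extendFrom Ω f, extendFrom_extends hfc, isDDC_closure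
    (continuousOn_extendFrom subset_rfl hf) (extendFrom_extends hfc) fun a ha => ?_⟩
  obtain ⟨b, hb, hab⟩ := hnear a ha
  obtain ⟨L, hL⟩ := exists_tendsto_entry (h (Matrix.diagonal fun _ => b)
    (diagonal_mem_diagMat fun _ => hb)) (bidiag n δ) 0 (Fin.last n) (s := distinctTuples n Ω)
    (x := fun _ => a) (r := ε / 4) (by positivity) (fun z hz hd => ⟨bidiag_mem_diagMat δ hz, by
      rw [bidiag, add_sub_right_comm]
      refine (norm_add_le _ _).trans_lt ?_
      have := hdiag a b hab z hd
      linarith⟩) (fun y y' => (dist_bidiag δ y y').le)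
  refine ⟨(δ ^ n)⁻¹ * L, (hL.const_mul (δ ^ n)⁻¹).congr' ?_⟩
  filter_upwards [self_mem_nhdsWithin] with z hz
  rw [diagCalc_bidiag f δ hz, inv_mul_cancel_left₀ (pow_ne_zero n hδ0)]

end Extension

end FunCalc

/-! ### The equivalence -/

theorem proposition5p7 (Ω : Set ℂ) (hΩ : Ω.Nonempty) (f : ℂ → ℂ) (k : ℕ) (hk : 2 ≤ k) :
    List.TFAE [
      ∃ ε : ℝ, 0 < ε ∧ ∀ X₀ ∈ FunCalc.diagMat k Ω,
        UniformContinuousOn (FunCalc.diagCalc f) {X | X ∈ FunCalc.diagMat k Ω ∧ ‖X - X₀‖ < ε},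
      ∀ S : Set (Matrix (Fin k) (Fin k) ℂ), S ⊆ FunCalc.diagMat k Ω → Bornology.IsBounded S →
        UniformContinuousOn (FunCalc.diagCalc f) S,
      ∃ F : ℂ → ℂ, Set.EqOn F f Ω ∧ FunCalc.IsDDC (k - 1) (closure Ω) F] ∧
    ∀ F : ℂ → ℂ, Set.EqOn F f Ω → FunCalc.IsDDC (k - 1) (closure Ω) F →
      FunCalc.IsTC (k - 1) (closure Ω) F ∧
      ∀ S : Set (Matrix (Fin k) (Fin k) ℂ), S ⊆ FunCalc.specInO k (closure Ω) →
        Bornology.IsBounded S → UniformContinuousOn (FunCalc.extCalc (closure Ω) F) S := by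
  refine ⟨?_, fun F _ hF => ⟨hF.isTC (by omega), fun S hS hb =>
    hF.uniformContinuousOn_extCalc (by omega) isClosed_closure hS hb⟩⟩
  tfae_have 1 → 3 := by
    rintro ⟨ε, hε, h⟩
    obtain ⟨n, rfl⟩ : ∃ n, k = n + 1 := ⟨k - 1, by omega⟩
    exact FunCalc.exists_isDDC_extension hε h
  tfae_have 3 → 2 := by
    rintro ⟨F, hfF, hF⟩ S hS hb
    exact (hF.uniformContinuousOn_extCalc (by omega) isClosed_closure
      (hS.trans (FunCalc.diagMat_subset_specInO subset_closure)) hb).congr fun M hM =>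
        FunCalc.extCalc_eq_diagCalc subset_closure hfF (hS hM)
  tfae_have 2 → 1 := fun h => ⟨1, one_pos, fun X₀ _ => h _ (fun _ hM => hM.1)
    ((Metric.isBounded_ball (x := X₀) (r := 1)).subset fun M hM => mem_ball_iff_norm.2 hM.2)⟩
  tfae_finish
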